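/- Let $\mathcal H$ be the Hilbert space of Dirichlet series $f(s)=\sum_{n\ge1}a_nn^{-s}$ with $\|f\|^2=\sum_{n\ge1}|a_n|^2<\infty$, regarded as functions on $\mathbb C_{1/2}$, where $\mathbb C_\theta=\{s\in\mathbb C:\operatorname{Re}s>\theta\}$. For $\varphi:\mathbb C_{1/2}\to\mathbb C_{1/2}$ put $C_\varphi f=f\circ\varphi$. The Gordon–Hedenmalm class $\mathcal G$ consists of the maps $\varphi:\mathbb C_{1/2}\to\mathbb C_{1/2}$ of the form $\varphi(s)=c_0s+\psi(s)$, where $c_0\ge0$ is an integer (the characteristic of $\varphi$), $\psi(s)=\sum_{n\ge1}c_nn^{-s}$ converges uniformly in $\mathbb C_\varepsilon$ for every $\varepsilon>0$, and: if $c_0=0$, then $\psi(\mathbb C_0)\subseteq\mathbb C_{1/2}$; if $c_0\ge1$, then either $\psi\equiv c_1$ with $\operatorname{Re}c_1\ge0$, or $\psi(\mathbb C_0)\subseteq\mathbb C_0$. A linear symbol is a map of the form $$\varphi(s)=c_0s+c_1+\sum_{k=1}^{d}c_{q_k}q_k^{-s},$$ where $d\ge 0$, the $q_k\neq1$ are multiplicatively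 independent positive integers (that is, $\prod_k q_k^{\alpha_k}=1$ with $\alpha_k\in\mathbb Z$ forces all $\alpha_k=0$), and every $c_{q_k}\ne0$. **Theorem.** Let $(\varphi_j)_{j=1,\dots,N}\subseteq\mathcal G$ be a finite sequence of distinct linear symbols with zero characteristic, and let $(\lambda_j)_{j=1,\dots,N}$ be a finite sequence of non-zero complex numbers. Then $\sum_{j=1}^N\lambda_jC_{\varphi_j}$ is a compact operator on $\mathcal H$ if and only if each $C_{\varphi_j}$ is a compact operator on $\mathcal H$. -/

import Mathlib

open Filter

/-- The open half-plane `ℂ_θ = {s : Re s > θ}`. -/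
abbrev HalfPlane (θ : ℝ) : Type := {s : ℂ // θ < s.re}

/-- The Hardy space `ℋ` of Dirichlet series `∑ aₙ n⁻ˢ` (`n ≥ 1`) with square summable
coefficients, normed by the `ℓ²` norm of the coefficients; an element is stored as its
coefficient sequence, and `DirichletHardy.toFunction` is the analytic function it represents. -/
abbrev DirichletHardy : Type := lp (fun _ : ℕ+ => ℂ) 2

namespace DirichletHardy

theorem summable_term (f : DirichletHardy) (s : HalfPlane (1 / 2)) :
    Summable (fun n : ℕ+ => f n * ((n : ℕ) : ℂ) ^ (-(s : ℂ))) := by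
  have h2 : Summable (fun n : ℕ+ => ‖f n‖ ^ 2) := by
    have h := (lp.memℓp f).summable (by norm_num)
    simpa using h
  have h3 : Summable (fun n : ℕ+ => (‖((n : ℕ) : ℂ) ^ (-(s : ℂ))‖) ^ 2) := by
    have h4 : Summable (fun n : ℕ => (n : ℝ) ^ (-(2 * (s : ℂ).re))) := by
      rw [Real.summable_nat_rpow]
      have := s.2
      linarith
    have h5 : Summable (fun n : ℕ+ => ((n : ℕ) : ℝ) ^ (-(2 * (s : ℂ).re))) :=
      h4.comp_injective PNat.coe_injective
    refine h5.congr fun n => ?_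
    rw [Complex.norm_natCast_cpow_of_pos n.pos, ← Real.rpow_natCast, ← Real.rpow_mul (by positivity)]
    congr 1
    simp
    ring
  refine Summable.of_norm_bounded (h2.add h3) fun n => ?_
  rw [norm_mul]
  nlinarith [sq_nonneg (‖f n‖ - ‖((n : ℕ) : ℂ) ^ (-(s : ℂ))‖), sq_nonneg (‖f n‖),
    sq_nonneg (‖((n : ℕ) : ℂ) ^ (-(s : ℂ))‖)]

/-- The function `s ↦ ∑ aₙ n⁻ˢ` on `ℂ_{1/2}` represented by an element of `ℋ`. -/
noncomputable def toFunction : DirichletHardy →ₗ[ℂ] (HalfPlane (1 / 2) → ℂ) where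
  toFun f s := ∑' n : ℕ+, f n * ((n : ℕ) : ℂ) ^ (-(s : ℂ))
  map_add' f g := by
    funext s
    rw [Pi.add_apply, ← (summable_term f s).tsum_add (summable_term g s)]
    exact tsum_congr fun n => by rw [lp.coeFn_add, Pi.add_apply, add_mul]
  map_smul' c f := by
    funext s
    rw [Pi.smul_apply, RingHom.id_apply, smul_eq_mul, ← tsum_mul_left]
    exact tsum_congr fun n => by rw [lp.coeFn_smul, Pi.smul_apply, smul_eq_mul, mul_assoc]

end DirichletHardy

/-- The composition operator `C_φ f = f ∘ φ`, sending `f ∈ ℋ` to a function on `ℂ_{1/2}`. -/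
noncomputable def compositionOperator (φ : HalfPlane (1 / 2) → HalfPlane (1 / 2)) :
    DirichletHardy →ₗ[ℂ] (HalfPlane (1 / 2) → ℂ) :=
  LinearMap.funLeft ℂ ℂ φ ∘ₗ DirichletHardy.toFunction

/-- A linear map `L` from `ℋ` to functions on `ℂ_{1/2}` is a compact operator on `ℋ`: it maps
`ℋ` into `ℋ`, and as an operator `ℋ → ℋ` it is bounded and compact. -/
def IsCompactOnHardy (L : DirichletHardy →ₗ[ℂ] (HalfPlane (1 / 2) → ℂ)) : Prop :=
  ∃ T : DirichletHardy →L[ℂ] DirichletHardy,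
    (∀ f, DirichletHardy.toFunction (T f) = L f) ∧ IsCompactOperator T

/-- `φ` belongs to the Gordon-Hedenmalm class and has characteristic `c₀`:
`φ(s) = c₀ s + ψ(s)` on `ℂ_{1/2}`, where `ψ(s) = ∑ cₙ n⁻ˢ` converges uniformly in `ℂ_ε` for every
`ε > 0`, with the required mapping properties of `ψ` on `ℂ_0`. -/
def IsGordonHedenmalm (c₀ : ℕ) (φ : HalfPlane (1 / 2) → HalfPlane (1 / 2)) : Prop :=
  ∃ (c : ℕ → ℂ) (ψ : ℂ → ℂ),
    (∀ ε : ℝ, 0 < ε → TendstoUniformlyOn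
      (fun (M : ℕ) (s : ℂ) => ∑ n ∈ Finset.Icc 1 M, c n * (n : ℂ) ^ (-s)) ψ atTop
      {s : ℂ | ε < s.re}) ∧
    (∀ s : HalfPlane (1 / 2), (φ s : ℂ) = (c₀ : ℂ) * (s : ℂ) + ψ s) ∧
    (c₀ = 0 → ∀ s : ℂ, 0 < s.re → 1 / 2 < (ψ s).re) ∧
    (1 ≤ c₀ →
      ((0 ≤ (c 1).re ∧ ∀ s : ℂ, 0 < s.re → ψ s = c 1) ∨ ∀ s : ℂ, 0 < s.re → 0 < (ψ s).re))

/-- Positive integers `q₁, …, q_d` are multiplicatively independent: `∏ q_k ^ α_k = 1` with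
integer exponents only when all exponents vanish. -/
def MultiplicativelyIndependent {d : ℕ} (q : Fin d → ℕ+) : Prop :=
  ∀ α : Fin d → ℤ, ∏ k, ((q k : ℕ) : ℚ) ^ α k = 1 → α = 0

/-- `φ` is a linear symbol with characteristic `c₀`:
`φ(s) = c₀ s + c₁ + ∑ₖ c_{qₖ} qₖ⁻ˢ` with multiplicatively independent positive integers `qₖ ≠ 1`
and nonzero coefficients `c_{qₖ}`. -/
def IsLinearSymbol (c₀ : ℕ) (φ : HalfPlane (1 / 2) → HalfPlane (1 / 2)) : Prop :=
  ∃ (c₁ : ℂ) (d : ℕ) (q : Fin d → ℕ+) (c : Fin d → ℂ),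
    MultiplicativelyIndependent q ∧ (∀ k, q k ≠ 1) ∧ (∀ k, c k ≠ 0) ∧
    ∀ s : HalfPlane (1 / 2),
      (φ s : ℂ) = (c₀ : ℂ) * (s : ℂ) + c₁ + ∑ k, c k * ((q k : ℕ) : ℂ) ^ (-(s : ℂ))

/-! Write a symbol as `a + ∑ c_k q_k⁻ˢ` and put `r = Re a - 1/2`. Since it maps the right half-plane
into `Re > 1/2`, a Bohr-type inequality for independent frequencies gives `∑ ‖c_k‖ ≤ r`: the values
of the symbol stay in the disc about `a` that touches the critical line.

Compactness. Expanding `f` at `a` gives `C_φ f = ∑ₘ tₘ(f) vₘ`, where `tₘ(f) = f⁽ᵐ⁾(a) rᵐ / m!` and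
`vₘ = (∑ (c_k / r) q_k⁻ˢ)ᵐ`. The sequence `tₘ(f)` is square summable with norm controlled by `‖f‖`
(a local embedding, proved by `taylorTerm_schur`), and the `vₘ` are mutually orthogonal by
multiplicative independence. Hence `C_φ` is compact as soon as `‖vₘ‖ → 0`. This is geometric decay
if `∑ ‖c_k‖ < r`. If `∑ ‖c_k‖ = r`, then `‖vₘ‖²` is a sum of squared multinomial probabilities,
which tends to `0` unless `d = 1`. The only symbols left are the touching ones, `a + c q⁻ˢ` with
`‖c‖ = r`.

Noncompactness. Subtracting the compact terms leaves a combination `T` of distinct touching symbols,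
and it must be shown that no cancellation makes it compact. Fix an integer `Q`, not a proper power,
of which one `q_j` is a power. A functional `e_z` replaces `Q⁻ˢ` by a point `z` of the unit disc and
kills every integer that is not a power of `Q`. Pairing it with `T` applied to a reproducing kernel
gives `∑ λ_j ζ(u + a_j + c_j z^{k_j})`, where `q_j = Q^{k_j}` and the power is dropped if there is
no such `k_j`. Let `z` and `u` tend to the boundary along parabolas with parameter `θ`, so that `θ
e_z` and `θ` times the kernel stay bounded. Compactness makes `θ²` times the sum tend to `0`, while
the pole of `ζ` gives each term a limit. Only symbols touching at the same point with the same
first-order speed `r_j k_j` survive, and they contribute `λ_j / (y + r_j (k_j + k_j²/2))` with a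
free parameter `y > 0`. These poles are distinct, so linear independence of simple fractions forces
`λ_j = 0`, a contradiction. -/

namespace DirichletHardy

open scoped InnerProductSpace ComplexConjugate

/-! ### Point evaluations, reproducing kernels and uniqueness of coefficients. -/

theorem memℓp_natCast_cpow_neg {u : ℂ} (hu : 1 / 2 < u.re) :
    Memℓp (fun n : ℕ+ => ((n : ℕ) : ℂ) ^ (-u)) 2 := by
  apply memℓp_gen
  have h4 : Summable (fun n : ℕ => (n : ℝ) ^ (-(2 * u.re))) := by
    rw [Real.summable_nat_rpow]
    linarith
  refine (h4.comp_injective PNat.coe_injective).congr fun n => ?_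
  simp only [Function.comp_apply, ENNReal.toReal_ofNat]
  rw [Complex.norm_natCast_cpow_of_pos n.pos, ← Real.rpow_mul (by positivity)]
  congr 1
  simp
  ring

/-- The reproducing kernel `∑ n⁻ᵘ n⁻ˢ = ζ(u + s)`. -/
noncomputable def kernel (u : ℂ) (hu : 1 / 2 < u.re) : DirichletHardy :=
  ⟨fun n => ((n : ℕ) : ℂ) ^ (-u), memℓp_natCast_cpow_neg hu⟩

theorem kernel_apply (u : ℂ) (hu : 1 / 2 < u.re) (n : ℕ+) :
    kernel u hu n = ((n : ℕ) : ℂ) ^ (-u) := rfl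

theorem toFunction_apply (f : DirichletHardy) (s : HalfPlane (1 / 2)) :
    toFunction f s = ∑' n : ℕ+, f n * ((n : ℕ) : ℂ) ^ (-(s : ℂ)) := rfl

theorem tsum_pnat_eq_tsum_add_one (f : ℕ → ℂ) : ∑' n : ℕ+, f n = ∑' n : ℕ, f (n + 1) := by
  rw [← Equiv.pnatEquivNat.symm.tsum_eq]
  rfl

theorem conj_natCast_cpow_neg (n : ℕ) (s : ℂ) :
    conj ((n : ℂ) ^ (-s)) = (n : ℂ) ^ (-(conj s)) := by
  rw [← map_neg, Complex.cpow_conj _ _ (by simp [Complex.natCast_arg, Real.pi_ne_zero.symm]),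
    Complex.conj_natCast]

theorem toFunction_eq_inner (f : DirichletHardy) (s : HalfPlane (1 / 2)) :
    toFunction f s = ⟪kernel (conj (s : ℂ)) (by simpa using s.2), f⟫_ℂ := by
  rw [lp.inner_eq_tsum, toFunction_apply]
  refine tsum_congr fun n => ?_
  rw [kernel_apply, RCLike.inner_apply, conj_natCast_cpow_neg, Complex.conj_conj]

theorem continuous_toFunction_apply (s : HalfPlane (1 / 2)) :
    Continuous fun f => toFunction f s := by
  simp only [toFunction_eq_inner]
  fun_prop

theorem toFunction_kernel (u : ℂ) (hu : 1 / 2 < u.re) (s : HalfPlane (1 / 2)) :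
    toFunction (kernel u hu) s = riemannZeta (u + s) := by
  have h1 : 1 < (u + s).re := by
    have := s.2
    rw [Complex.add_re]
    linarith
  rw [zeta_eq_tsum_one_div_nat_cpow h1, toFunction_apply]
  have := tsum_pnat_eq_tsum_add_one (f := fun n : ℕ => 1 / (n : ℂ) ^ (u + (s : ℂ)))
  rw [(Complex.summable_one_div_nat_cpow.2 h1).tsum_eq_zero_add, ← this]
  rw [Nat.cast_zero, Complex.zero_cpow (by intro h; rw [h] at h1; simp at h1; linarith)]
  simp only [div_zero, zero_add]
  refine tsum_congr fun n => ?_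
  rw [kernel_apply, ← Complex.cpow_add _ _ (by simp), ← neg_add]
  exact (Complex.cpow_neg _ _).trans (one_div _).symm

theorem norm_sq_kernel (u : ℂ) (hu : 1 / 2 < u.re) :
    ((‖kernel u hu‖ ^ 2 : ℝ) : ℂ) = riemannZeta (2 * u.re) := by
  have h := toFunction_kernel u hu ⟨conj u, by simpa using hu⟩
  rw [toFunction_eq_inner] at h
  simp only [Complex.conj_conj] at h
  rw [inner_self_eq_norm_sq_to_K, Complex.add_conj] at h
  push_cast at h ⊢
  exact h

theorem toFunction_injective : Function.Injective toFunction := by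
  intro f g hfg
  rw [← sub_eq_zero]
  set h := f - g with hh
  have h0 : ∀ s, toFunction h s = 0 := fun s => by simp [hh, map_sub, hfg]
  -- Extension by zero to index `0` gives a bounded sequence, so its L-series converges absolutely
  -- for `Re s > 1` and the uniqueness theorem for L-series applies.
  let b : ℕ → ℂ := fun n => if hn : 0 < n then h ⟨n, hn⟩ else 0
  have hb : ∀ n : ℕ+, b n = h n := fun n => by simp only [b, n.pos, dif_pos]; rfl
  have hbd : ∀ n, ‖b n‖ ≤ ‖h‖ := fun n => by
    by_cases hn : 0 < n
    · simpa [b, hn] using lp.norm_apply_le_norm (by norm_num) h ⟨n, hn⟩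
    · simp [b, hn]
  have habs : LSeries.abscissaOfAbsConv b < ⊤ := by
    refine lt_of_le_of_lt (LSeries.abscissaOfAbsConv_le_of_le_const ⟨‖h‖, fun n _ => hbd n⟩) ?_
    exact_mod_cast EReal.coe_lt_top 1
  have hz : LSeries.abscissaOfAbsConv (0 : ℕ → ℂ) < ⊤ := by
    refine lt_of_le_of_lt (LSeries.abscissaOfAbsConv_le_of_le_const ⟨0, fun n _ => by simp⟩) ?_
    exact_mod_cast EReal.coe_lt_top 1
  have hev : (fun x : ℝ => LSeries b x) =ᶠ[atTop] fun x => LSeries 0 x := by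
    filter_upwards [eventually_gt_atTop (1 : ℝ)] with x hx
    have h1 := h0 ⟨(x : ℂ), by simp; linarith⟩
    have hsum : LSeriesSummable b x :=
      LSeriesSummable_of_bounded_of_one_lt_re (fun n _ => hbd n) (by simpa using hx)
    rw [LSeries_zero, Pi.zero_apply, LSeries, hsum.tsum_eq_zero_add, LSeries.term_zero, zero_add,
      ← tsum_pnat_eq_tsum_add_one (f := LSeries.term b x), ← h1, toFunction_apply]
    refine tsum_congr fun n => ?_
    rw [LSeries.term_of_ne_zero n.ne_zero, hb, Complex.cpow_neg]
    rfl
  ext n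
  have := LSeries.eq_of_LSeries_eventually_eq habs hz hev n.ne_zero
  rw [hb] at this
  simpa using this

theorem toFunction_single (n : ℕ+) (s : HalfPlane (1 / 2)) :
    toFunction (lp.single 2 n (1 : ℂ)) s = ((n : ℕ) : ℂ) ^ (-(s : ℂ)) := by
  rw [toFunction_apply, tsum_eq_single n]
  · simp
  · intro m hm
    rw [lp.single_apply_ne _ _ _ hm, zero_mul]

end DirichletHardy

/-! ### The Schur test and sums of Poisson weights. -/

/-- The Schur test with row weights `1` and column weights `w`. -/
theorem schur_test {ι : Type*} {K : ℕ → ι → ℝ} {w : ι → ℝ} {C : ℝ} (hK : ∀ m i, 0 ≤ K m i)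
    (hw : ∀ i, 0 < w i) (hcol : ∀ i (s : Finset ℕ), ∑ m ∈ s, K m i ≤ w i)
    (hrow : ∀ m (s : Finset ι), ∑ i ∈ s, K m i * w i ≤ C)
    {f : ι → ℝ} (hf0 : ∀ i, 0 ≤ f i) (hf : Summable fun i => f i ^ 2) :
    (∀ m, Summable fun i => K m i * f i) ∧
      ∀ s : Finset ℕ, ∑ m ∈ s, (∑' i, K m i * f i) ^ 2 ≤ C * ∑' i, f i ^ 2 := by
  have hC : 0 ≤ C := by simpa using hrow 0 ∅
  have h1 : ∀ m, Summable fun i => K m i * w i := fun m =>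
    summable_of_sum_le (fun i => mul_nonneg (hK m i) (hw i).le) (hrow m)
  have h1' : ∀ m, ∑' i, K m i * w i ≤ C := fun m => (h1 m).tsum_le_of_sum_le (hrow m)
  have hle : ∀ m i, K m i * (f i ^ 2 / w i) ≤ f i ^ 2 := fun m i => by
    have : K m i ≤ w i := by simpa using hcol i {m}
    rw [mul_div_assoc', div_le_iff₀ (hw i), mul_comm]
    exact mul_le_mul_of_nonneg_left this (sq_nonneg _)
  have h2 : ∀ m, Summable fun i => K m i * (f i ^ 2 / w i) := fun m =>
    hf.of_nonneg_of_le (fun i => mul_nonneg (hK m i) (div_nonneg (sq_nonneg _) (hw i).le)) (hle m)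
  have hsq1 : ∀ m i, √(K m i * w i) ^ (2 : ℝ) = K m i * w i := fun m i => by
    rw [Real.rpow_two, Real.sq_sqrt (mul_nonneg (hK m i) (hw i).le)]
  have hsq2 : ∀ m i, √(K m i * (f i ^ 2 / w i)) ^ (2 : ℝ) = K m i * (f i ^ 2 / w i) := fun m i => by
    rw [Real.rpow_two, Real.sq_sqrt (mul_nonneg (hK m i) (div_nonneg (sq_nonneg _) (hw i).le))]
  -- Cauchy–Schwarz is applied to the factorisation `K f = √(K w) · √(K f² / w)`.
  have hprod : ∀ m i, √(K m i * w i) * √(K m i * (f i ^ 2 / w i)) = K m i * f i := fun m i => by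
    rw [← Real.sqrt_mul (mul_nonneg (hK m i) (hw i).le)]
    have : K m i * w i * (K m i * (f i ^ 2 / w i)) = (K m i * f i) ^ 2 := by
      have := (hw i).ne'
      field_simp
    rw [this, Real.sqrt_sq (mul_nonneg (hK m i) (hf0 i))]
  have hcs := fun m => Real.summable_and_inner_le_Lp_mul_Lq_tsum_of_nonneg (f := fun i => √(K m i * w i))
    (g := fun i => √(K m i * (f i ^ 2 / w i))) Real.HolderConjugate.two_two
    (fun i => Real.sqrt_nonneg _) (fun i => Real.sqrt_nonneg _)
    (by simpa only [hsq1] using h1 m) (by simpa only [hsq2] using h2 m)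
  simp only [hsq1, hsq2, hprod] at hcs
  refine ⟨fun m => (hcs m).1, fun s => ?_⟩
  have hmain : ∀ m, (∑' i, K m i * f i) ^ 2 ≤ C * ∑' i, K m i * (f i ^ 2 / w i) := fun m => by
    have hA : 0 ≤ ∑' i, K m i * w i := tsum_nonneg fun i => mul_nonneg (hK m i) (hw i).le
    have hB : 0 ≤ ∑' i, K m i * (f i ^ 2 / w i) :=
      tsum_nonneg fun i => mul_nonneg (hK m i) (div_nonneg (sq_nonneg _) (hw i).le)
    have h0 : 0 ≤ ∑' i, K m i * f i := tsum_nonneg fun i => mul_nonneg (hK m i) (hf0 i)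
    calc (∑' i, K m i * f i) ^ 2
        ≤ ((∑' i, K m i * w i) ^ (1 / 2 : ℝ) *
            (∑' i, K m i * (f i ^ 2 / w i)) ^ (1 / 2 : ℝ)) ^ 2 :=
          pow_le_pow_left₀ h0 (hcs m).2 2
      _ = (∑' i, K m i * w i) * ∑' i, K m i * (f i ^ 2 / w i) := by
          rw [← Real.sqrt_eq_rpow, ← Real.sqrt_eq_rpow, mul_pow, Real.sq_sqrt hA, Real.sq_sqrt hB]
      _ ≤ _ := mul_le_mul_of_nonneg_right (h1' m) hB
  calc ∑ m ∈ s, (∑' i, K m i * f i) ^ 2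
      ≤ ∑ m ∈ s, C * ∑' i, K m i * (f i ^ 2 / w i) := Finset.sum_le_sum fun m _ => hmain m
    _ = C * ∑' i, ∑ m ∈ s, K m i * (f i ^ 2 / w i) := by
        rw [← Finset.mul_sum, Summable.tsum_finsetSum fun m _ => h2 m]
    _ ≤ C * ∑' i, f i ^ 2 := by
        refine mul_le_mul_of_nonneg_left ?_ hC
        refine Summable.tsum_le_tsum (fun i => ?_) (summable_sum fun m _ => h2 m) hf
        rw [← Finset.sum_mul, mul_div_assoc', div_le_iff₀ (hw i), mul_comm]
        exact mul_le_mul_of_nonneg_left (hcol i s) (sq_nonneg _)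

/-- The weight `e⁻ˣ xᵐ / m!` of the Poisson distribution. -/
noncomputable def poissonWeight (m : ℕ) (x : ℝ) : ℝ := Real.exp (-x) * (x ^ m / m.factorial)

theorem poissonWeight_nonneg (m : ℕ) {x : ℝ} (hx : 0 ≤ x) : 0 ≤ poissonWeight m x := by
  unfold poissonWeight; positivity

theorem hasSum_poissonWeight (x : ℝ) : HasSum (fun m => poissonWeight m x) 1 := by
  have := (NormedSpace.expSeries_div_hasSum_exp x).mul_left (Real.exp (-x))
  rwa [← Real.exp_eq_exp_ℝ, ← Real.exp_add, neg_add_cancel, Real.exp_zero] at this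

theorem sum_poissonWeight_le (s : Finset ℕ) {x : ℝ} (hx : 0 ≤ x) :
    ∑ m ∈ s, poissonWeight m x ≤ 1 :=
  sum_le_hasSum s (fun m _ => poissonWeight_nonneg m hx) (hasSum_poissonWeight x)

/-- The derivative telescopes: each weight differentiates to the difference of two consecutive
weights. It makes the Poisson distribution function a primitive, up to sign, of a single weight. -/
theorem hasDerivAt_sum_poissonWeight (m : ℕ) (x : ℝ) :
    HasDerivAt (fun x => ∑ j ∈ Finset.range (m + 1), poissonWeight j x) (-poissonWeight m x) x := by
  induction m with
  | zero =>
    have := (hasDerivAt_neg x).exp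
    simpa [poissonWeight] using this
  | succ m ih =>
    simp only [Finset.sum_range_succ _ (m + 1)]
    have h := ((hasDerivAt_neg x).exp).mul
      ((hasDerivAt_pow (m + 1) x).div_const ((m + 1).factorial : ℝ))
    refine (ih.add h).congr_deriv ?_
    simp only [poissonWeight, Nat.factorial_succ, Nat.cast_mul, Nat.cast_add, Nat.cast_one,
      Nat.add_sub_cancel]
    have h1 : (m.factorial : ℝ) ≠ 0 := by positivity
    have h2 : (m : ℝ) + 1 ≠ 0 := by positivity
    field_simp
    ring

/-- By the mean value theorem the difference of distribution functions is `η` times the weight at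
some `ξ` in `(x, x + η)`. Moving from `x` to `ξ` the factor `xᵐ` only grows and the exponential
loses at most `e^{-η}`. -/
theorem mul_poissonWeight_le (m : ℕ) {x η : ℝ} (hx : 0 ≤ x) (hη : 0 < η) :
    η * poissonWeight m x ≤ Real.exp η * (∑ j ∈ Finset.range (m + 1), poissonWeight j x -
      ∑ j ∈ Finset.range (m + 1), poissonWeight j (x + η)) := by
  obtain ⟨ξ, ⟨h1, h2⟩, h3⟩ := exists_hasDerivAt_eq_slope
    (fun x => ∑ j ∈ Finset.range (m + 1), poissonWeight j x) (fun x => -poissonWeight m x)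
    (lt_add_of_pos_right x hη)
    (fun y _ => (hasDerivAt_sum_poissonWeight m y).continuousAt.continuousWithinAt)
    (fun y _ => hasDerivAt_sum_poissonWeight m y)
  rw [add_sub_cancel_left, eq_div_iff hη.ne'] at h3
  have h4 : Real.exp (-η) * poissonWeight m x ≤ poissonWeight m ξ := by
    unfold poissonWeight
    rw [← mul_assoc, ← Real.exp_add]
    gcongr
    linarith
  have h5 : poissonWeight m x ≤ Real.exp η * poissonWeight m ξ := by
    rw [Real.exp_neg, inv_mul_le_iff₀ (Real.exp_pos η)] at h4
    exact h4
  have h6 := mul_le_mul_of_nonneg_left h5 hη.le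
  calc _ ≤ _ := h6
    _ = Real.exp η * (poissonWeight m ξ * η) := by ring
    _ = _ := by congr 1; linarith

/-- A discrete form of `∫ poissonWeight m (r log x) dx / x = 1 / r`. Steps of `r log n` have length
`η` with `r / (2n) ≤ η ≤ r log 2`, so each term is bounded by an increment of the Poisson
distribution function. The increments telescope to at most `1`, uniformly in `m`. -/
theorem sum_range_poissonWeight_log_le {r : ℝ} (hr : 0 < r) (m N : ℕ) :
    ∑ n ∈ Finset.range N, poissonWeight m (r * Real.log ((n + 1 : ℕ) : ℝ)) / ((n + 1 : ℕ) : ℝ) ≤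
      2 / r * Real.exp (r * Real.log 2) := by
  set G : ℕ → ℝ := fun n =>
    ∑ j ∈ Finset.range (m + 1), poissonWeight j (r * Real.log ((n + 1 : ℕ) : ℝ)) with hG
  have hlog : ∀ n : ℕ, 0 ≤ r * Real.log ((n + 1 : ℕ) : ℝ) := fun n =>
    mul_nonneg hr.le (Real.log_natCast_nonneg _)
  have hstep : ∀ n : ℕ, poissonWeight m (r * Real.log ((n + 1 : ℕ) : ℝ)) / ((n + 1 : ℕ) : ℝ) ≤
      2 / r * Real.exp (r * Real.log 2) * (G n - G (n + 1)) := fun n => by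
    have hk : (0 : ℝ) < ((n + 1 : ℕ) : ℝ) := by positivity
    have hk1 : (1 : ℝ) ≤ ((n + 1 : ℕ) : ℝ) := by exact_mod_cast Nat.succ_le_succ (Nat.zero_le n)
    set k : ℝ := ((n + 1 : ℕ) : ℝ) with hkdef
    have hk' : ((n + 1 + 1 : ℕ) : ℝ) = k + 1 := by rw [hkdef]; push_cast; ring
    set η := r * (Real.log (k + 1) - Real.log k) with hηdef
    have hl1 : 1 / (2 * k) ≤ Real.log (k + 1) - Real.log k := by
      rw [← Real.log_div (by positivity) hk.ne']
      have := Real.one_sub_inv_le_log_of_pos (x := (k + 1) / k) (by positivity)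
      refine le_trans ?_ this
      rw [inv_div, one_sub_div (by positivity), add_sub_cancel_left]
      gcongr
      linarith
    have hl2 : Real.log (k + 1) - Real.log k ≤ Real.log 2 := by
      rw [← Real.log_div (by positivity) hk.ne']
      refine Real.log_le_log (by positivity) ?_
      rw [div_le_iff₀ hk]
      linarith
    have hη : 0 < η := mul_pos hr (lt_of_lt_of_le (by positivity) hl1)
    have hp := poissonWeight_nonneg m (hlog n)
    have h := mul_poissonWeight_le m (hlog n) hη
    have hx : r * Real.log k + η = r * Real.log ((n + 1 + 1 : ℕ) : ℝ) := by rw [hk', hηdef]; ring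
    rw [hx] at h
    change η * _ ≤ Real.exp η * (G n - G (n + 1)) at h
    have hGG : 0 ≤ G n - G (n + 1) := by
      by_contra hneg
      have : Real.exp η * (G n - G (n + 1)) < 0 := mul_neg_of_pos_of_neg (Real.exp_pos _) (by linarith)
      have := mul_nonneg hη.le hp
      linarith
    have h3 : poissonWeight m (r * Real.log k) / k ≤ 2 / r * (η * poissonWeight m (r * Real.log k)) := by
      have : r / (2 * k) ≤ η := by
        have := mul_le_mul_of_nonneg_left hl1 hr.le
        rwa [mul_one_div] at this
      calc poissonWeight m (r * Real.log k) / k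
          = 2 / r * (r / (2 * k) * poissonWeight m (r * Real.log k)) := by field_simp
        _ ≤ _ := by gcongr
    refine h3.trans ?_
    rw [mul_assoc (2 / r)]
    refine mul_le_mul_of_nonneg_left (h.trans ?_) (by positivity)
    refine mul_le_mul_of_nonneg_right (Real.exp_le_exp.2 ?_) hGG
    exact mul_le_mul_of_nonneg_left hl2 hr.le
  refine (Finset.sum_le_sum fun n _ => hstep n).trans ?_
  rw [← Finset.mul_sum, Finset.sum_range_sub']
  refine mul_le_of_le_one_right (by positivity) ?_
  have h1 : G 0 ≤ 1 := sum_poissonWeight_le _ (hlog 0)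
  have h2 : 0 ≤ G N := Finset.sum_nonneg fun j _ => poissonWeight_nonneg j (hlog N)
  linarith

theorem sum_pnat_poissonWeight_log_le {r : ℝ} (hr : 0 < r) (m : ℕ) (s : Finset ℕ+) :
    ∑ n ∈ s, poissonWeight m (r * Real.log ((n : ℕ) : ℝ)) / ((n : ℕ) : ℝ) ≤
      2 / r * Real.exp (r * Real.log 2) := by
  obtain ⟨N, hN⟩ := (s.image PNat.natPred).exists_nat_subset_range
  refine le_trans ?_ (sum_range_poissonWeight_log_le hr m N)
  refine le_trans (le_of_eq ?_) (Finset.sum_le_sum_of_subset_of_nonneg hN fun n _ _ =>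
    div_nonneg (poissonWeight_nonneg m
      (mul_nonneg hr.le (Real.log_natCast_nonneg _))) (Nat.cast_nonneg _))
  rw [Finset.sum_image fun x _ y _ h => PNat.natPred_injective h]
  exact Finset.sum_congr rfl fun n _ => by rw [PNat.natPred_add_one]

/-! ### Taylor coefficients on a disc touching the critical line. -/

namespace DirichletHardy

open scoped InnerProductSpace ComplexConjugate

theorem summable_sq_norm (f : DirichletHardy) : Summable fun n : ℕ+ => ‖f n‖ ^ 2 := by
  simpa using (lp.memℓp f).summable (by norm_num)

theorem norm_sq_eq_tsum (f : DirichletHardy) : ‖f‖ ^ 2 = ∑' n : ℕ+, ‖f n‖ ^ 2 := by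
  simpa using lp.norm_rpow_eq_tsum (p := 2) (by norm_num) f

/-- The coefficient with which `f n` enters the Taylor coefficient of order `m` at `a`, normalised
by the radius `Re a - 1 / 2`. -/
noncomputable def taylorTerm (a : ℂ) (m : ℕ) (n : ℕ+) : ℂ :=
  ((n : ℕ) : ℂ) ^ (-a) * ((-(((a.re - 1 / 2) * Real.log (n : ℕ) : ℝ)) : ℂ) ^ m / m.factorial)

/-- With `r = Re a - 1/2`, the factor `n^{-Re a}` splits as `n^{-1/2} e^{-r log n}`; the second part
is exactly the Poisson normalisation at `r log n`. -/
theorem norm_taylorTerm {a : ℂ} (ha : 1 / 2 < a.re) (m : ℕ) (n : ℕ+) :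
    ‖taylorTerm a m n‖ = ((n : ℕ) : ℝ) ^ (-(1 / 2) : ℝ) *
      poissonWeight m ((a.re - 1 / 2) * Real.log (n : ℕ)) := by
  have hn : (0 : ℝ) < (n : ℕ) := by exact_mod_cast n.pos
  have hl : 0 ≤ (a.re - 1 / 2) * Real.log (n : ℕ) :=
    mul_nonneg (by linarith) (Real.log_natCast_nonneg _)
  rw [taylorTerm, poissonWeight, norm_mul, norm_div, norm_pow, norm_neg, Complex.norm_real,
    Real.norm_of_nonneg hl, Complex.norm_natCast, Complex.norm_natCast_cpow_of_pos n.pos,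
    ← mul_assoc]
  congr 1
  have : Real.exp (-((a.re - 1 / 2) * Real.log (n : ℕ))) = ((n : ℕ) : ℝ) ^ (-(a.re - 1 / 2)) := by
    rw [Real.rpow_def_of_pos hn]
    ring_nf
  rw [this, ← Real.rpow_add hn]
  congr 1
  rw [Complex.neg_re]
  ring

/-- The Schur test with weight `n^{-1/2}`: summing over `m` uses that Poisson weights have total
mass `1`, and summing over `n` is the uniform bound for `∑ poissonWeight m (r log n) / n`. This is
the embedding of the space into the Hardy space of the touching disc. -/
theorem taylorTerm_schur {a : ℂ} (ha : 1 / 2 < a.re) (f : DirichletHardy) :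
    (∀ m, Summable fun n => ‖taylorTerm a m n‖ * ‖f n‖) ∧
      ∀ s : Finset ℕ, ∑ m ∈ s, (∑' n, ‖taylorTerm a m n‖ * ‖f n‖) ^ 2 ≤
        2 / (a.re - 1 / 2) * Real.exp ((a.re - 1 / 2) * Real.log 2) * ‖f‖ ^ 2 := by
  have hr : 0 < a.re - 1 / 2 := by linarith
  have hn : ∀ n : ℕ+, (0 : ℝ) < (n : ℕ) := fun n => by exact_mod_cast n.pos
  have hl : ∀ n : ℕ+, 0 ≤ (a.re - 1 / 2) * Real.log (n : ℕ) := fun n =>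
    mul_nonneg hr.le (Real.log_natCast_nonneg _)
  rw [norm_sq_eq_tsum]
  refine schur_test (w := fun n : ℕ+ => ((n : ℕ) : ℝ) ^ (-(1 / 2) : ℝ))
    (fun m n => norm_nonneg _) (fun n => Real.rpow_pos_of_pos (hn n) _) (fun n s => ?_)
    (fun m s => ?_) (fun n => norm_nonneg _) (summable_sq_norm f)
  · simp only [norm_taylorTerm ha, ← Finset.mul_sum]
    exact mul_le_of_le_one_right (Real.rpow_nonneg (hn n).le _) (sum_poissonWeight_le s (hl n))
  · refine le_trans (le_of_eq (Finset.sum_congr rfl fun n _ => ?_))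
      (sum_pnat_poissonWeight_log_le hr m s)
    rw [norm_taylorTerm ha, mul_right_comm, ← Real.rpow_add (hn n)]
    rw [show (-(1 / 2) : ℝ) + -(1 / 2) = -1 by norm_num, Real.rpow_neg_one, mul_comm]
    exact (div_eq_mul_inv _ _).symm

theorem summable_taylorTerm {a : ℂ} (ha : 1 / 2 < a.re) (m : ℕ) (f : DirichletHardy) :
    Summable fun n => taylorTerm a m n * f n :=
  Summable.of_norm (by simpa only [norm_mul] using (taylorTerm_schur ha f).1 m)

/-- `DirichletHardy.taylorCoeff` as a linear map. -/
noncomputable def taylorCoeffLinear (a : ℂ) (ha : 1 / 2 < a.re) (m : ℕ) :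
    DirichletHardy →ₗ[ℂ] ℂ where
  toFun f := ∑' n, taylorTerm a m n * f n
  map_add' f g := by
    rw [← (summable_taylorTerm ha m f).tsum_add (summable_taylorTerm ha m g)]
    exact tsum_congr fun n => by rw [lp.coeFn_add, Pi.add_apply, mul_add]
  map_smul' c f := by
    rw [RingHom.id_apply, smul_eq_mul, ← tsum_mul_left]
    exact tsum_congr fun n => by rw [lp.coeFn_smul, Pi.smul_apply, smul_eq_mul, mul_left_comm]

/-- A bound for `∑ ‖taylorCoeff a ha m f‖ ^ 2` over the unit ball. -/
noncomputable def taylorBound (a : ℂ) : ℝ :=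
  2 / (a.re - 1 / 2) * Real.exp ((a.re - 1 / 2) * Real.log 2)

theorem taylorBound_nonneg {a : ℂ} (ha : 1 / 2 < a.re) : 0 ≤ taylorBound a := by
  have hr : 0 < a.re - 1 / 2 := by linarith
  unfold taylorBound
  positivity

theorem taylorCoeffLinear_sum_le {a : ℂ} (ha : 1 / 2 < a.re) (f : DirichletHardy) (s : Finset ℕ) :
    ∑ m ∈ s, ‖taylorCoeffLinear a ha m f‖ ^ 2 ≤ taylorBound a * ‖f‖ ^ 2 := by
  refine (Finset.sum_le_sum fun m _ => ?_).trans ((taylorTerm_schur ha f).2 s)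
  refine pow_le_pow_left₀ (norm_nonneg _) ?_ 2
  refine (norm_tsum_le_tsum_norm ?_).trans_eq (by simp only [norm_mul])
  simpa only [norm_mul] using (taylorTerm_schur ha f).1 m

/-- The functional `f ↦ f⁽ᵐ⁾(a) (Re a - 1 / 2)ᵐ / m!`. -/
noncomputable def taylorCoeff (a : ℂ) (ha : 1 / 2 < a.re) (m : ℕ) : DirichletHardy →L[ℂ] ℂ :=
  (taylorCoeffLinear a ha m).mkContinuous √(taylorBound a) fun f => by
    have h := taylorCoeffLinear_sum_le ha f {m}
    rw [Finset.sum_singleton] at h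
    rw [← Real.sqrt_sq (norm_nonneg f), ← Real.sqrt_mul (taylorBound_nonneg ha)]
    exact Real.le_sqrt_of_sq_le h

theorem taylorCoeff_apply (a : ℂ) (ha : 1 / 2 < a.re) (m : ℕ) (f : DirichletHardy) :
    taylorCoeff a ha m f = ∑' n, taylorTerm a m n * f n := rfl

theorem taylorCoeff_sum_le {a : ℂ} (ha : 1 / 2 < a.re) (f : DirichletHardy) (s : Finset ℕ) :
    ∑ m ∈ s, ‖taylorCoeff a ha m f‖ ^ 2 ≤ taylorBound a * ‖f‖ ^ 2 :=
  taylorCoeffLinear_sum_le ha f s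

theorem hasSum_taylorTerm_pow (a : ℂ) (ha : 1 / 2 < a.re) (w : ℂ) (n : ℕ+) :
    HasSum (fun m => taylorTerm a m n * (w / ((a.re - 1 / 2 : ℝ) : ℂ)) ^ m)
      (((n : ℕ) : ℂ) ^ (-(a + w))) := by
  have hr : ((a.re - 1 / 2 : ℝ) : ℂ) ≠ 0 := by
    exact_mod_cast (by linarith : a.re - 1 / 2 ≠ 0)
  have h := (NormedSpace.expSeries_div_hasSum_exp (-(w * Complex.log (n : ℕ)))).mul_left
    (((n : ℕ) : ℂ) ^ (-a))
  rw [← Complex.exp_eq_exp_ℂ] at h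
  have h0 : ((n : ℕ) : ℂ) ≠ 0 := by simp
  have h1 : ∀ m, taylorTerm a m n * (w / ((a.re - 1 / 2 : ℝ) : ℂ)) ^ m = ((n : ℕ) : ℂ) ^ (-a) *
      ((-(w * Complex.log (n : ℕ))) ^ m / m.factorial) := fun m => by
    unfold taylorTerm
    rw [mul_assoc, div_mul_eq_mul_div, ← mul_pow]
    congr 3
    rw [← Complex.natCast_log]
    generalize a.re - 1 / 2 = r at hr
    push_cast
    field_simp
  have h2 : ((n : ℕ) : ℂ) ^ (-(a + w)) = ((n : ℕ) : ℂ) ^ (-a) *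
      Complex.exp (-(w * Complex.log (n : ℕ))) := by
    rw [neg_add, Complex.cpow_add _ _ h0, Complex.cpow_def_of_ne_zero h0 (-w), mul_neg, mul_comm w]
  simpa only [h1, h2] using h

/-- Expand `n^{-(a + w)}` as an exponential series and interchange the sums. The interchange is
legitimate because the absolute values sum to `∑ ‖f n‖ n^{-(Re a - ‖w‖)}`, and `Re a - ‖w‖ > 1/2`.
-/
theorem hasSum_taylorCoeff {a : ℂ} (ha : 1 / 2 < a.re) {w : ℂ} (hw : ‖w‖ < a.re - 1 / 2)
    (f : DirichletHardy) (s : HalfPlane (1 / 2)) (hs : (s : ℂ) = a + w) :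
    HasSum (fun m => taylorCoeff a ha m f * (w / ((a.re - 1 / 2 : ℝ) : ℂ)) ^ m)
      (toFunction f s) := by
  have hr : 0 < a.re - 1 / 2 := by linarith
  set F : ℕ+ × ℕ → ℂ := fun p => taylorTerm a p.2 p.1 * f p.1 * (w / ((a.re - 1 / 2 : ℝ) : ℂ)) ^ p.2
    with hF
  have hfib : ∀ n, HasSum (fun m => F (n, m)) (f n * ((n : ℕ) : ℂ) ^ (-(s : ℂ))) := fun n => by
    have h := (hasSum_taylorTerm_pow a ha w n).mul_left (f n)
    rw [hs]
    refine h.congr_fun fun m => ?_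
    change taylorTerm a m n * f n * _ = _
    rw [mul_right_comm, mul_comm]
  have hnorm : ∀ n m, ‖F (n, m)‖ = ‖f n‖ * (((n : ℕ) : ℝ) ^ (-a.re) *
      ((‖w‖ * Real.log (n : ℕ)) ^ m / m.factorial)) := fun n m => by
    have hl : 0 ≤ (a.re - 1 / 2) * Real.log (n : ℕ) :=
      mul_nonneg (by linarith) (Real.log_natCast_nonneg _)
    change ‖((n : ℕ) : ℂ) ^ (-a) * _ * f n * _‖ = _
    rw [norm_mul, norm_mul, norm_mul, norm_div, norm_pow, norm_pow, norm_div, norm_neg,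
      Complex.norm_real, Complex.norm_real, Real.norm_of_nonneg hl, Real.norm_of_nonneg hr.le,
      Complex.norm_natCast, Complex.norm_natCast_cpow_of_pos n.pos, Complex.neg_re, mul_pow, mul_pow,
      div_pow]
    generalize a.re - 1 / 2 = r at hr
    field_simp
  have hfibn : ∀ n, HasSum (fun m => ‖F (n, m)‖) (‖f n‖ * ((n : ℕ) : ℝ) ^ (-(a.re - ‖w‖))) :=
    fun n => by
      have hn : (0 : ℝ) < (n : ℕ) := by exact_mod_cast n.pos
      simp only [hnorm]
      refine HasSum.mul_left _ ?_
      have h := (NormedSpace.expSeries_div_hasSum_exp (‖w‖ * Real.log (n : ℕ))).mul_left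
        (((n : ℕ) : ℝ) ^ (-a.re))
      rw [← Real.exp_eq_exp_ℝ] at h
      rwa [mul_comm ‖w‖ (Real.log _), ← Real.rpow_def_of_pos hn ‖w‖, ← Real.rpow_add hn,
        neg_add_eq_sub, ← neg_sub, mul_comm (Real.log _)] at h
  have hsum : Summable F := by
    refine Summable.of_norm ?_
    rw [summable_prod_of_nonneg fun _ => norm_nonneg _]
    refine ⟨fun n => (hfibn n).summable, ?_⟩
    simp only [(hfibn _).tsum_eq]
    have h := (summable_term f ⟨((a.re - ‖w‖ : ℝ) : ℂ), by
      rw [Complex.ofReal_re]; linarith⟩).norm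
    refine h.congr fun n => ?_
    rw [norm_mul, Complex.norm_natCast_cpow_of_pos n.pos, Complex.neg_re, Complex.ofReal_re]
  have h1 : toFunction f s = ∑' p, F p := by
    rw [toFunction_apply]
    exact (hsum.hasSum.prod_fiberwise hfib).tsum_eq
  have h2 : HasSum (fun p : ℕ × ℕ+ => F (p.2, p.1)) (∑' p, F p) :=
    (Equiv.hasSum_iff (Equiv.prodComm ℕ ℕ+)).2 hsum.hasSum
  have h3 : ∀ m, HasSum (fun n => F (n, m))
      (taylorCoeff a ha m f * (w / ((a.re - 1 / 2 : ℝ) : ℂ)) ^ m) := fun m => by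
    have h := (summable_taylorTerm ha m f).hasSum.mul_right
      ((w / ((a.re - 1 / 2 : ℝ) : ℂ)) ^ m)
    rw [← taylorCoeff_apply a ha] at h
    exact h.congr_fun fun n => rfl
  rw [h1]
  exact HasSum.prod_fiberwise (f := fun p : ℕ × ℕ+ => F (p.2, p.1)) h2 h3

end DirichletHardy

/-! ### Operators defined by orthogonal expansions. -/

section Orthogonal

open scoped InnerProductSpace

variable {E : Type*} [NormedAddCommGroup E] [InnerProductSpace ℂ E]

theorem norm_sum_smul_sq_of_orthogonal {v : ℕ → E} (hv : Pairwise fun i j => ⟪v i, v j⟫_ℂ = 0)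
    (x : ℕ → ℂ) (s : Finset ℕ) :
    ‖∑ m ∈ s, x m • v m‖ ^ 2 = ∑ m ∈ s, ‖x m‖ ^ 2 * ‖v m‖ ^ 2 := by
  induction s using Finset.induction_on with
  | empty => simp
  | insert m s hm ih =>
    rw [Finset.sum_insert hm, Finset.sum_insert hm, @norm_add_sq ℂ, ih, inner_sum,
      Finset.sum_eq_zero, norm_smul, mul_pow]
    · simp
    · intro i hi
      rw [inner_smul_left, inner_smul_right, hv (ne_of_mem_of_not_mem hi hm).symm, mul_zero, mul_zero]

theorem summable_smul_of_orthogonal [CompleteSpace E] {v : ℕ → E}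
    (hv : Pairwise fun i j => ⟪v i, v j⟫_ℂ = 0) {B C : ℝ} (hB : ∀ m, ‖v m‖ ≤ B) {x : ℕ → ℂ}
    (hx : ∀ s : Finset ℕ, ∑ m ∈ s, ‖x m‖ ^ 2 ≤ C) :
    Summable (fun m => x m • v m) ∧ ‖∑' m, x m • v m‖ ^ 2 ≤ B ^ 2 * C := by
  have hle : ∀ s : Finset ℕ, ‖∑ m ∈ s, x m • v m‖ ^ 2 ≤ B ^ 2 * ∑ m ∈ s, ‖x m‖ ^ 2 := fun s => by
    rw [norm_sum_smul_sq_of_orthogonal hv, Finset.mul_sum]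
    refine Finset.sum_le_sum fun m _ => ?_
    rw [mul_comm]
    exact mul_le_mul_of_nonneg_right (pow_le_pow_left₀ (norm_nonneg _) (hB m) 2) (sq_nonneg _)
  have hxs : Summable fun m => ‖x m‖ ^ 2 := summable_of_sum_le (fun _ => sq_nonneg _) hx
  have hs : Summable fun m => x m • v m := by
    rw [summable_iff_vanishing_norm]
    intro ε hε
    obtain ⟨s, hs⟩ := summable_iff_vanishing_norm.1 hxs (ε ^ 2 / (B ^ 2 + 1)) (by positivity)
    refine ⟨s, fun t ht => ?_⟩
    have h1 := hs t ht
    rw [Real.norm_of_nonneg (Finset.sum_nonneg fun _ _ => sq_nonneg _), lt_div_iff₀ (by positivity)]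
      at h1
    refine lt_of_pow_lt_pow_left₀ 2 hε.le ((hle t).trans_lt (lt_of_le_of_lt ?_ h1))
    rw [mul_comm]
    exact mul_le_mul_of_nonneg_left (by linarith) (Finset.sum_nonneg fun _ _ => sq_nonneg _)
  refine ⟨hs, le_of_tendsto (hs.hasSum.norm.pow 2) (Eventually.of_forall fun s => ?_)⟩
  exact (hle s).trans (mul_le_mul_of_nonneg_left (hx s) (sq_nonneg _))

end Orthogonal

namespace DirichletHardy

open scoped InnerProductSpace ComplexConjugate

theorem exists_taylorOperator {a : ℂ} (ha : 1 / 2 < a.re) {v : ℕ → DirichletHardy}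
    (hv : Pairwise fun i j => ⟪v i, v j⟫_ℂ = 0) {B : ℝ} (hB0 : 0 ≤ B) (hB : ∀ m, ‖v m‖ ≤ B) :
    ∃ T : DirichletHardy →L[ℂ] DirichletHardy,
      (∀ f, HasSum (fun m => taylorCoeff a ha m f • v m) (T f)) ∧ ‖T‖ ≤ B * √(taylorBound a) := by
  have hs : ∀ f, Summable (fun m => taylorCoeff a ha m f • v m) ∧
      ‖∑' m, taylorCoeff a ha m f • v m‖ ^ 2 ≤ B ^ 2 * (taylorBound a * ‖f‖ ^ 2) := fun f =>
    summable_smul_of_orthogonal hv hB (taylorCoeff_sum_le ha f)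
  let L : DirichletHardy →ₗ[ℂ] DirichletHardy :=
    { toFun := fun f => ∑' m, taylorCoeff a ha m f • v m
      map_add' := fun f g => by
        rw [← (hs f).1.tsum_add (hs g).1]
        exact tsum_congr fun m => by rw [map_add, add_smul]
      map_smul' := fun c f => by
        rw [RingHom.id_apply, ← (hs f).1.tsum_const_smul]
        exact tsum_congr fun m => by rw [map_smul, smul_assoc] }
  have hL : ∀ f, ‖L f‖ ≤ B * √(taylorBound a) * ‖f‖ := fun f => by
    refine le_of_sq_le_sq ((hs f).2.trans_eq ?_)  (by positivity)
    rw [mul_pow, mul_pow, Real.sq_sqrt (taylorBound_nonneg ha), mul_assoc]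
  exact ⟨L.mkContinuous _ hL, fun f => (hs f).1.hasSum,
    L.mkContinuous_norm_le (by positivity) hL⟩

theorem isCompactOperator_smulRight (ℓ : DirichletHardy →L[ℂ] ℂ) (v : DirichletHardy) :
    IsCompactOperator (ℓ.smulRight v) := by
  have h : IsCompactOperator ℓ :=
    isCompactOperator_of_locallyCompactSpace_dom ℓ
  exact h.clm_comp (ContinuousLinearMap.toSpanSingleton ℂ v)

/-- The partial sums have finite rank, and they converge in operator norm: the tail is an operator
of the same kind whose vectors are uniformly small. -/
theorem isCompactOperator_taylorOperator {a : ℂ} (ha : 1 / 2 < a.re) {v : ℕ → DirichletHardy}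
    (hv : Pairwise fun i j => ⟪v i, v j⟫_ℂ = 0) (hlim : Tendsto (fun m => ‖v m‖) atTop (nhds 0))
    {T : DirichletHardy →L[ℂ] DirichletHardy}
    (hT : ∀ f, HasSum (fun m => taylorCoeff a ha m f • v m) (T f)) : IsCompactOperator T := by
  let F : ℕ → DirichletHardy →L[ℂ] DirichletHardy := fun N =>
    ∑ m ∈ Finset.range N, (taylorCoeff a ha m).smulRight (v m)
  have hF : ∀ N, IsCompactOperator (F N) := fun N =>
    (compactOperator (RingHom.id ℂ) DirichletHardy DirichletHardy).sum_mem
      fun m _ => isCompactOperator_smulRight _ _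
  refine isCompactOperator_of_tendsto (F := F) (l := atTop) ?_ (Eventually.of_forall hF)
  rw [tendsto_iff_norm_sub_tendsto_zero]
  rw [Metric.tendsto_atTop]
  intro ε hε
  obtain ⟨N₀, hN₀⟩ := (Metric.tendsto_atTop.1 hlim) (ε / (2 * (√(taylorBound a) + 1)))
    (by positivity)
  refine ⟨N₀, fun N hN => ?_⟩
  -- Zeroing the first `N` vectors keeps orthogonality, so the norm bound of `exists_taylorOperator`
  -- applies to the tail.
  let v' : ℕ → DirichletHardy := fun m => if m < N then 0 else v m
  have hv' : Pairwise fun i j => ⟪v' i, v' j⟫_ℂ = 0 := fun i j hij => by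
    by_cases hi : i < N
    · simp [v', hi]
    · by_cases hj : j < N
      · simp [v', hj]
      · simpa [v', hi, hj] using hv hij
  have hB' : ∀ m, ‖v' m‖ ≤ ε / (2 * (√(taylorBound a) + 1)) := fun m => by
    by_cases hm : m < N
    · simp only [v', hm, if_true, norm_zero]; positivity
    · have := hN₀ m (by omega)
      simp only [v', hm, if_false]
      simpa using this.le
  obtain ⟨T', hT', hn⟩ := exists_taylorOperator ha hv' (by positivity) hB'
  have hdiff : F N - T = -T' := by
    ext1 f
    have h1 : HasSum (fun m => taylorCoeff a ha m f • (v m - v' m)) (F N f) := by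
      have : F N f = ∑ m ∈ Finset.range N, taylorCoeff a ha m f • (v m - v' m) := by
        simp only [F, _root_.sum_apply, ContinuousLinearMap.smulRight_apply]
        exact Finset.sum_congr rfl fun m hm => by simp [v', Finset.mem_range.1 hm]
      rw [this]
      exact hasSum_sum_of_ne_finset_zero fun m hm => by
        simp [v', show ¬ m < N by simpa using hm]
    have h2 := (hT f).sub (hT' f)
    simp only [← smul_sub] at h2
    have h3 := h1.unique h2
    simp only [_root_.sub_apply, _root_.neg_apply, h3]
    abel
  rw [hdiff, norm_neg, Real.dist_eq, sub_zero, abs_of_nonneg (norm_nonneg _)]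
  refine hn.trans_lt ?_
  rw [div_mul_eq_mul_div, div_lt_iff₀ (by positivity)]
  have := Real.sqrt_nonneg (taylorBound a)
  nlinarith

/-! ### Powers of linear Dirichlet polynomials. -/

/-- The product `∏ q_k ^ α_k`. -/
def monomialIndex {d : ℕ} (q : Fin d → ℕ+) (α : Fin d → ℕ) : ℕ+ := ∏ k, q k ^ α k

theorem monomialIndex_injective {d : ℕ} {q : Fin d → ℕ+} (hq : MultiplicativelyIndependent q) :
    Function.Injective (monomialIndex q) := by
  intro α β h
  have h0 : ∀ k, ((q k : ℕ) : ℚ) ≠ 0 := fun k => by simp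
  have h1 : ∏ k, ((q k : ℕ) : ℚ) ^ α k = ∏ k, ((q k : ℕ) : ℚ) ^ β k := by
    have := congrArg (fun n : ℕ+ => ((n : ℕ) : ℚ)) h
    simpa [monomialIndex] using this
  have h2 := hq (fun k => (α k : ℤ) - β k) (by
    simp only [zpow_sub₀ (h0 _), zpow_natCast, Finset.prod_div_distrib, h1]
    exact div_self (Finset.prod_ne_zero_iff.2 fun k _ => pow_ne_zero _ (h0 k)))
  ext k
  have := congrFun h2 k
  simp only [Pi.zero_apply] at this
  omega

theorem monomialIndex_cpow {d : ℕ} (q : Fin d → ℕ+) (α : Fin d → ℕ) (s : ℂ) :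
    ((monomialIndex q α : ℕ) : ℂ) ^ s = ∏ k, (((q k : ℕ) : ℂ) ^ s) ^ α k := by
  let h : ℕ+ →* ℂ :=
    { toFun := fun n => ((n : ℕ) : ℂ) ^ s
      map_one' := by simp
      map_mul' := fun m n => by
        rw [PNat.mul_coe, Nat.cast_mul, Complex.natCast_mul_natCast_cpow] }
  change h (∏ k, q k ^ α k) = ∏ k, h (q k) ^ α k
  simp only [map_prod, map_pow]

/-- The Dirichlet polynomial `(∑ k, x_k q_k⁻ˢ) ^ m`. -/
noncomputable def powVec {d : ℕ} (q : Fin d → ℕ+) (x : Fin d → ℂ) (m : ℕ) : DirichletHardy :=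
  ∑ α ∈ Finset.piAntidiag Finset.univ m,
    ((Nat.multinomial Finset.univ α : ℂ) * ∏ k, x k ^ α k) • lp.single 2 (monomialIndex q α) (1 : ℂ)

theorem toFunction_powVec {d : ℕ} (q : Fin d → ℕ+) (x : Fin d → ℂ) (m : ℕ)
    (s : HalfPlane (1 / 2)) :
    toFunction (powVec q x m) s = (∑ k, x k * ((q k : ℕ) : ℂ) ^ (-(s : ℂ))) ^ m := by
  rw [powVec, map_sum, Finset.sum_apply, Finset.sum_pow_eq_sum_piAntidiag]
  refine Finset.sum_congr rfl fun α _ => ?_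
  rw [map_smul, Pi.smul_apply, toFunction_single, monomialIndex_cpow, smul_eq_mul, mul_assoc,
    ← Finset.prod_mul_distrib]
  simp only [mul_pow]

theorem inner_single_single (i j : ℕ+) :
    ⟪(lp.single 2 i (1 : ℂ) : DirichletHardy), lp.single 2 j (1 : ℂ)⟫_ℂ = if i = j then 1 else 0 := by
  rw [lp.inner_single_left]
  by_cases h : i = j
  · subst h; simp
  · rw [lp.single_apply_ne _ _ _ h]; simp [h]

/-- By independence an integer `∏ q_k ^ α_k` determines `α`, hence its total degree, so different
powers share no frequency. -/
theorem inner_powVec {d : ℕ} {q : Fin d → ℕ+} (hq : MultiplicativelyIndependent q)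
    (x : Fin d → ℂ) {m m' : ℕ} (h : m ≠ m') : ⟪powVec q x m, powVec q x m'⟫_ℂ = 0 := by
  rw [powVec, powVec, sum_inner]
  refine Finset.sum_eq_zero fun α hα => ?_
  rw [inner_sum]
  refine Finset.sum_eq_zero fun β hβ => ?_
  rw [inner_smul_left, inner_smul_right, inner_single_single, if_neg, mul_zero, mul_zero]
  intro hαβ
  rw [monomialIndex_injective hq hαβ] at hα
  exact h ((Finset.mem_piAntidiag.1 hα).1.symm.trans (Finset.mem_piAntidiag.1 hβ).1)

theorem norm_sq_powVec {d : ℕ} {q : Fin d → ℕ+} (hq : MultiplicativelyIndependent q)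
    (x : Fin d → ℂ) (m : ℕ) : ‖powVec q x m‖ ^ 2 = ∑ α ∈ Finset.piAntidiag Finset.univ m,
      ((Nat.multinomial Finset.univ α : ℝ) * ∏ k, ‖x k‖ ^ α k) ^ 2 := by
  have ho : Orthonormal ℂ fun α => (lp.single 2 (monomialIndex q α) (1 : ℂ) : DirichletHardy) := by
    rw [orthonormal_iff_ite]
    intro α β
    rw [inner_single_single]
    simp only [(monomialIndex_injective hq).eq_iff]
  have h := (inner_self_eq_norm_sq_to_K (𝕜 := ℂ) (powVec q x m)).symm.trans (ho.inner_sum _ _ _)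
  have h2 : ∀ z : ℂ, conj z * z = ((‖z‖ ^ 2 : ℝ) : ℂ) := fun z => by
    rw [Complex.conj_mul']; norm_cast
  simp only [h2] at h
  rw [← Complex.ofReal_sum] at h
  refine Complex.ofReal_injective ((Complex.ofReal_pow _ _).trans (h.trans (congrArg _ ?_)))
  refine Finset.sum_congr rfl fun α _ => ?_
  simp

theorem norm_powVec_le {d : ℕ} (q : Fin d → ℕ+) (x : Fin d → ℂ) (m : ℕ) :
    ‖powVec q x m‖ ≤ (∑ k, ‖x k‖) ^ m := by
  rw [powVec, Finset.sum_pow_eq_sum_piAntidiag]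
  refine (norm_sum_le _ _).trans (Finset.sum_le_sum fun α _ => ?_)
  rw [norm_smul, lp.norm_single (by norm_num)]
  simp

/-- If `∑ ‖c_k‖ ≤ Re a - 1 / 2`, then composition with `s ↦ a + ∑ c_k q_k⁻ˢ` is a bounded operator,
obtained by expanding `f` at `a`. -/
theorem exists_operator_of_sum_norm_le {a : ℂ} (ha : 1 / 2 < a.re) {d : ℕ} {q : Fin d → ℕ+}
    (hq : MultiplicativelyIndependent q) (hq1 : ∀ k, q k ≠ 1) {c : Fin d → ℂ}
    (hc : ∑ k, ‖c k‖ ≤ a.re - 1 / 2) {φ : HalfPlane (1 / 2) → HalfPlane (1 / 2)}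
    (hφ : ∀ s, (φ s : ℂ) = a + ∑ k, c k * ((q k : ℕ) : ℂ) ^ (-(s : ℂ))) :
    ∃ T : DirichletHardy →L[ℂ] DirichletHardy,
      (∀ f, toFunction (T f) = compositionOperator φ f) ∧
      ∀ f, HasSum (fun m => taylorCoeff a ha m f •
        powVec q (fun k => c k / ((a.re - 1 / 2 : ℝ) : ℂ)) m) (T f) := by
  have hr : 0 < a.re - 1 / 2 := by linarith
  set x : Fin d → ℂ := fun k => c k / ((a.re - 1 / 2 : ℝ) : ℂ) with hx
  have hxs : ∑ k, ‖x k‖ ≤ 1 := by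
    simp only [hx, norm_div, Complex.norm_real, Real.norm_of_nonneg hr.le, ← Finset.sum_div]
    exact (div_le_one hr).2 hc
  obtain ⟨T, hT, -⟩ := exists_taylorOperator ha (v := powVec q x)
    (fun i j hij => inner_powVec hq x hij) zero_le_one
    (fun m => (norm_powVec_le q x m).trans (pow_le_one₀ (by positivity) hxs))
  refine ⟨T, fun f => funext fun s => ?_, hT⟩
  have h1 : HasSum (fun m => toFunction (taylorCoeff a ha m f • powVec q x m) s)
      (toFunction (T f) s) :=
    (hT f).map ((LinearMap.proj s).comp toFunction : DirichletHardy →ₗ[ℂ] ℂ)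
      (continuous_toFunction_apply s)
  simp only [map_smul, Pi.smul_apply, toFunction_powVec, smul_eq_mul] at h1
  set w := ∑ k, c k * ((q k : ℕ) : ℂ) ^ (-(s : ℂ)) with hw
  have hwx : ∑ k, x k * ((q k : ℕ) : ℂ) ^ (-(s : ℂ)) = w / ((a.re - 1 / 2 : ℝ) : ℂ) := by
    rw [hw, Finset.sum_div]
    exact Finset.sum_congr rfl fun k _ => by rw [hx]; ring
  rw [hwx] at h1
  -- Strictness survives the case `∑ ‖c_k‖ = Re a - 1/2` because `q_k ≥ 2` and `Re s > 0` give a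
  -- factor `2^{-Re s} < 1`.
  have hwn : ‖w‖ < a.re - 1 / 2 := by
    have hσ : 0 < (s : ℂ).re := lt_trans (by norm_num) s.2
    have hle : ∀ k, ‖((q k : ℕ) : ℂ) ^ (-(s : ℂ))‖ ≤ (2 : ℝ) ^ (-(s : ℂ).re) := fun k => by
      rw [Complex.norm_natCast_cpow_of_pos (q k).pos, Complex.neg_re]
      refine Real.rpow_le_rpow_of_nonpos (by norm_num) ?_ (by linarith)
      exact_mod_cast (Nat.two_le_iff _).2 ⟨(q k).ne_zero, fun h => hq1 k (PNat.coe_eq_one_iff.1 h)⟩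
    have hρ : (2 : ℝ) ^ (-(s : ℂ).re) < 1 :=
      Real.rpow_lt_one_of_one_lt_of_neg (by norm_num) (by linarith)
    calc ‖w‖ ≤ ∑ k, ‖c k‖ * (2 : ℝ) ^ (-(s : ℂ).re) :=
          (norm_sum_le _ _).trans (Finset.sum_le_sum fun k _ => by
            rw [norm_mul]
            exact mul_le_mul_of_nonneg_left (hle k) (norm_nonneg _))
      _ ≤ (a.re - 1 / 2) * (2 : ℝ) ^ (-(s : ℂ).re) := by
          rw [← Finset.sum_mul]
          exact mul_le_mul_of_nonneg_right hc (by positivity)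
      _ < a.re - 1 / 2 := mul_lt_of_lt_one_right hr hρ
  exact h1.unique (hasSum_taylorCoeff ha hwn f (φ s) (hφ s))

end DirichletHardy

/-! ### Decay of multinomial probabilities. -/

theorem integral_exp_int_mul_I {n : ℤ} (hn : n ≠ 0) :
    ∫ θ in (0 : ℝ)..2 * Real.pi, Complex.exp (n * Complex.I * θ) = 0 := by
  have hc : (n : ℂ) * Complex.I ≠ 0 := mul_ne_zero (by exact_mod_cast hn) Complex.I_ne_zero
  rw [integral_exp_mul_complex hc]
  have : (n : ℂ) * Complex.I * ((2 * Real.pi : ℝ) : ℂ) = n * (2 * Real.pi * Complex.I) := by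
    push_cast; ring
  rw [this, Complex.exp_int_mul_two_pi_mul_I]
  simp

theorem norm_sq_mul_exp_add_one_sub (p θ : ℝ) :
    ‖(p : ℂ) * Complex.exp (θ * Complex.I) + (1 - p : ℝ)‖ ^ 2 =
      1 - 2 * p * (1 - p) * (1 - Real.cos θ) := by
  rw [← Complex.normSq_eq_norm_sq, Complex.normSq_apply]
  simp only [Complex.add_re, Complex.add_im, Complex.re_ofReal_mul, Complex.im_ofReal_mul,
    Complex.exp_ofReal_mul_I_re, Complex.exp_ofReal_mul_I_im, Complex.ofReal_re, Complex.ofReal_im]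
  have := Real.sin_sq_add_cos_sq θ
  linear_combination p ^ 2 * this

/-- For `0 < p < 1` the modulus is below `1` except at multiples of `2π`, so dominated convergence
applies. The integrand is the modulus of the characteristic function of a binomial law. -/
theorem tendsto_integral_norm_pow {p : ℝ} (h0 : 0 < p) (h1 : p < 1) :
    Tendsto (fun m : ℕ => ∫ θ in (0 : ℝ)..2 * Real.pi,
      ‖(p : ℂ) * Complex.exp (θ * Complex.I) + (1 - p : ℝ)‖ ^ m) atTop (nhds 0) := by
  have hle : ∀ θ : ℝ, ‖(p : ℂ) * Complex.exp (θ * Complex.I) + (1 - p : ℝ)‖ ≤ 1 := fun θ => by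
    refine (norm_add_le _ _).trans ?_
    rw [norm_mul, Complex.norm_exp_ofReal_mul_I, Complex.norm_real, Complex.norm_real,
      Real.norm_of_nonneg h0.le, Real.norm_of_nonneg (by linarith)]
    linarith
  have h := intervalIntegral.tendsto_integral_filter_of_dominated_convergence
    (μ := MeasureTheory.volume) (a := 0) (b := 2 * Real.pi) (l := atTop)
    (F := fun (m : ℕ) (θ : ℝ) => ‖(p : ℂ) * Complex.exp (θ * Complex.I) + (1 - p : ℝ)‖ ^ m)
    (f := fun _ => 0) (fun _ => 1) (Eventually.of_forall fun m => by
      refine Continuous.aestronglyMeasurable ?_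
      fun_prop) (Eventually.of_forall fun m => Eventually.of_forall fun θ _ => by
        rw [norm_pow, norm_norm]
        exact pow_le_one₀ (norm_nonneg _) (hle θ)) (by simp) (by
      have hae : ∀ᵐ θ : ℝ, θ ≠ 2 * Real.pi := by
        simp [MeasureTheory.ae_iff]
      filter_upwards [hae] with θ hθ hmem
      rw [Set.uIoc_of_le (by positivity)] at hmem
      refine tendsto_pow_atTop_nhds_zero_of_lt_one (norm_nonneg _) ?_
      have hcos : Real.cos θ < 1 := by
        refine lt_of_le_of_ne (Real.cos_le_one θ) fun h => ?_
        have := (Real.cos_eq_one_iff_of_lt_of_lt (by linarith [Real.pi_pos, hmem.1])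
          (lt_of_le_of_ne hmem.2 hθ)).1 h
        exact hmem.1.ne' this
      rw [← sq_lt_one_iff₀ (norm_nonneg _), norm_sq_mul_exp_add_one_sub]
      have : 0 < 2 * p * (1 - p) * (1 - Real.cos θ) :=
        mul_pos (mul_pos (by linarith) (by linarith)) (by linarith)
      linarith)
  simpa using h

/-- A multinomial probability is at most the mean value of the characteristic function of one of
its marginals. -/
theorem multinomial_mul_prod_le {d : ℕ} {p : Fin d → ℝ} (hp : ∀ k, 0 ≤ p k) (hp1 : ∑ k, p k = 1)
    (k₀ : Fin d) {m : ℕ} {α : Fin d → ℕ} (hα : α ∈ Finset.piAntidiag Finset.univ m) :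
    (Nat.multinomial Finset.univ α : ℝ) * ∏ k, p k ^ α k ≤
      (2 * Real.pi)⁻¹ * ∫ θ in (0 : ℝ)..2 * Real.pi,
        ‖(p k₀ : ℂ) * Complex.exp (θ * Complex.I) + (1 - p k₀ : ℝ)‖ ^ m := by
  classical
  set P : (Fin d → ℕ) → ℝ := fun β => (Nat.multinomial Finset.univ β : ℝ) * ∏ k, p k ^ β k with hP
  have hP0 : ∀ β, 0 ≤ P β := fun β =>
    mul_nonneg (Nat.cast_nonneg _) (Finset.prod_nonneg fun k _ => pow_nonneg (hp k) _)
  -- Attach `e^{iθ}` to the variable `k₀` alone in the multinomial expansion; the extra exponential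
  -- selects the exponent `α k₀` upon integration.
  have hexpand : ∀ θ : ℝ, ((p k₀ : ℂ) * Complex.exp (θ * Complex.I) + (1 - p k₀ : ℝ)) ^ m *
      Complex.exp (-(α k₀ : ℂ) * Complex.I * θ) =
      ∑ β ∈ Finset.piAntidiag Finset.univ m,
        (P β : ℂ) * Complex.exp (((β k₀ - α k₀ : ℤ) : ℂ) * Complex.I * θ) := fun θ => by
    have h1 : (p k₀ : ℂ) * Complex.exp (θ * Complex.I) + (1 - p k₀ : ℝ) =
        ∑ k, (p k : ℂ) * (if k = k₀ then Complex.exp (θ * Complex.I) else 1) := by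
      have h3 : 1 - p k₀ = ∑ k ∈ Finset.univ.erase k₀, p k := by
        rw [← hp1, ← Finset.add_sum_erase Finset.univ p (Finset.mem_univ k₀), add_sub_cancel_left]
      rw [← Finset.add_sum_erase Finset.univ (fun k => (p k : ℂ) * _) (Finset.mem_univ k₀),
        if_pos rfl, h3, Complex.ofReal_sum]
      congr 1
      refine Finset.sum_congr rfl fun k hk => ?_
      rw [if_neg (Finset.ne_of_mem_erase hk), mul_one]
    rw [h1, Finset.sum_pow_eq_sum_piAntidiag, Finset.sum_mul]
    refine Finset.sum_congr rfl fun β _ => ?_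
    have h2 : ∏ k, ((p k : ℂ) * (if k = k₀ then Complex.exp (θ * Complex.I) else 1)) ^ β k =
        (∏ k, (p k : ℂ) ^ β k) * Complex.exp (θ * Complex.I) ^ β k₀ := by
      simp only [mul_pow, Finset.prod_mul_distrib, ite_pow, one_pow]
      rw [Finset.prod_ite_eq']
      simp
    rw [h2, ← Complex.exp_nat_mul, hP]
    push_cast
    rw [← mul_assoc, mul_assoc _ (Complex.exp _) (Complex.exp _), ← Complex.exp_add]
    congr 2
    ring
  have hint : ∫ θ in (0 : ℝ)..2 * Real.pi, ((p k₀ : ℂ) * Complex.exp (θ * Complex.I) +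
      (1 - p k₀ : ℝ)) ^ m * Complex.exp (-(α k₀ : ℂ) * Complex.I * θ) =
      ((2 * Real.pi * ∑ β ∈ Finset.piAntidiag Finset.univ m with β k₀ = α k₀, P β : ℝ) : ℂ) := by
    simp only [hexpand]
    rw [intervalIntegral.integral_finsetSum fun β _ => by
      refine Continuous.intervalIntegrable ?_ _ _
      fun_prop]
    rw [Finset.sum_filter, Finset.mul_sum, Complex.ofReal_sum]
    refine Finset.sum_congr rfl fun β _ => ?_
    rw [intervalIntegral.integral_const_mul]
    by_cases h : β k₀ = α k₀
    · simp [h]; ring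
    · rw [integral_exp_int_mul_I (by omega), if_neg h]; simp
  have hnorm := intervalIntegral.norm_integral_le_integral_norm (μ := MeasureTheory.volume)
    (f := fun θ : ℝ => ((p k₀ : ℂ) * Complex.exp (θ * Complex.I) +
      (1 - p k₀ : ℝ)) ^ m * Complex.exp (-(α k₀ : ℂ) * Complex.I * θ))
    (by positivity : (0 : ℝ) ≤ 2 * Real.pi)
  have he : ∀ θ : ℝ, ‖Complex.exp (-(α k₀ : ℂ) * Complex.I * θ)‖ = 1 := fun θ => by
    rw [show -(α k₀ : ℂ) * Complex.I * θ = ((-(α k₀ * θ) : ℝ) : ℂ) * Complex.I by push_cast; ring,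
      Complex.norm_exp_ofReal_mul_I]
  rw [hint] at hnorm
  simp only [norm_mul, he, mul_one, norm_pow] at hnorm
  rw [Complex.norm_real] at hnorm
  have hle : P α ≤ ∑ β ∈ Finset.piAntidiag Finset.univ m with β k₀ = α k₀, P β :=
    Finset.single_le_sum (f := P) (fun β _ => hP0 β) (Finset.mem_filter.2 ⟨hα, rfl⟩)
  change P α ≤ _
  rw [le_inv_mul_iff₀ (by positivity)]
  refine le_trans (mul_le_mul_of_nonneg_left hle (by positivity)) ((le_abs_self _).trans hnorm)

/-! ### Compactness of the operators that are not touching. -/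

namespace DirichletHardy

theorem tendsto_norm_powVec_of_lt {d : ℕ} (q : Fin d → ℕ+) {x : Fin d → ℂ}
    (hx : ∑ k, ‖x k‖ < 1) : Tendsto (fun m => ‖powVec q x m‖) atTop (nhds 0) :=
  squeeze_zero (fun _ => norm_nonneg _) (norm_powVec_le q x)
    (tendsto_pow_atTop_nhds_zero_of_lt_one (by positivity) hx)

/-- The squared norm is `∑ P(α)²` for a multinomial law `P`, hence at most `max P`, which tends to
`0` as soon as one marginal is nondegenerate. That needs at least two nonzero coefficients; for `d =
1` the norm is constantly `1`. -/
theorem tendsto_norm_powVec_of_eq {d : ℕ} {q : Fin d → ℕ+} (hq : MultiplicativelyIndependent q)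
    {x : Fin d → ℂ} (hx : ∑ k, ‖x k‖ = 1) (hx0 : ∀ k, x k ≠ 0) (hd : d ≠ 1) :
    Tendsto (fun m => ‖powVec q x m‖) atTop (nhds 0) := by
  rcases Nat.lt_or_ge d 2 with hd2 | hd2
  · obtain rfl : d = 0 := by omega
    simp at hx
  have hpos : ∀ k, 0 < ‖x k‖ := fun k => norm_pos_iff.2 (hx0 k)
  let k₀ : Fin d := ⟨0, by omega⟩
  let k₁ : Fin d := ⟨1, by omega⟩
  have hlt : ‖x k₀‖ < 1 := by
    rw [← hx]
    exact Finset.single_lt_sum (i := k₀) (j := k₁) (by simp [k₀, k₁]) (Finset.mem_univ _)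
      (Finset.mem_univ _) (hpos _) fun k _ _ => (hpos k).le
  set I : ℕ → ℝ := fun m => (2 * Real.pi)⁻¹ * ∫ θ in (0 : ℝ)..2 * Real.pi,
        ‖((‖x k₀‖ : ℝ) : ℂ) * Complex.exp (θ * Complex.I) + (1 - ‖x k₀‖ : ℝ)‖ ^ m with hI
  have hIlim : Tendsto I atTop (nhds 0) := by
    have := (tendsto_integral_norm_pow (hpos k₀) hlt).const_mul (2 * Real.pi)⁻¹
    rwa [mul_zero] at this
  have hsq : ∀ m, ‖powVec q x m‖ ^ 2 ≤ I m := fun m => by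
    rw [norm_sq_powVec hq]
    have hsum : ∑ α ∈ Finset.piAntidiag Finset.univ m,
        ((Nat.multinomial Finset.univ α : ℝ) * ∏ k, ‖x k‖ ^ α k) = 1 := by
      rw [← Finset.sum_pow_eq_sum_piAntidiag, hx, one_pow]
    calc _ ≤ ∑ α ∈ Finset.piAntidiag Finset.univ m,
          I m * ((Nat.multinomial Finset.univ α : ℝ) * ∏ k, ‖x k‖ ^ α k) := by
          refine Finset.sum_le_sum fun α hα => ?_
          rw [sq]
          exact mul_le_mul_of_nonneg_right
            (multinomial_mul_prod_le (fun k => (hpos k).le) hx k₀ hα) (by positivity)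
      _ = I m := by rw [← Finset.mul_sum, hsum, mul_one]
  have h2 : Tendsto (fun m => ‖powVec q x m‖ ^ 2) atTop (nhds 0) :=
    squeeze_zero (fun _ => sq_nonneg _) hsq hIlim
  simpa using h2.sqrt

theorem isCompactOnHardy_linearSymbol {a : ℂ} (ha : 1 / 2 < a.re) {d : ℕ} {q : Fin d → ℕ+}
    (hq : MultiplicativelyIndependent q) (hq1 : ∀ k, q k ≠ 1) {c : Fin d → ℂ} (hc0 : ∀ k, c k ≠ 0)
    (hc : ∑ k, ‖c k‖ ≤ a.re - 1 / 2) (h : d = 1 → ∑ k, ‖c k‖ < a.re - 1 / 2)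
    {φ : HalfPlane (1 / 2) → HalfPlane (1 / 2)}
    (hφ : ∀ s, (φ s : ℂ) = a + ∑ k, c k * ((q k : ℕ) : ℂ) ^ (-(s : ℂ))) :
    IsCompactOnHardy (compositionOperator φ) := by
  obtain ⟨T, hT, hsum⟩ := exists_operator_of_sum_norm_le ha hq hq1 hc hφ
  refine ⟨T, hT, isCompactOperator_taylorOperator ha (fun i j hij => inner_powVec hq _ hij) ?_ hsum⟩
  have hr : 0 < a.re - 1 / 2 := by linarith
  have hr' : ((a.re - 1 / 2 : ℝ) : ℂ) ≠ 0 := by exact_mod_cast hr.ne'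
  have hx : ∑ k, ‖c k / ((a.re - 1 / 2 : ℝ) : ℂ)‖ = (∑ k, ‖c k‖) / (a.re - 1 / 2) := by
    simp only [norm_div, Complex.norm_real, Real.norm_of_nonneg hr.le, ← Finset.sum_div]
  rcases hc.lt_or_eq with hlt | heq
  · exact tendsto_norm_powVec_of_lt q (by rw [hx]; exact (div_lt_one hr).2 hlt)
  · exact tendsto_norm_powVec_of_eq hq (by rw [hx, heq]; exact div_self hr.ne')
      (fun k => div_ne_zero (hc0 k) hr') fun hd => (h hd).ne heq

end DirichletHardy

/-! ### The coefficient bound for symbols in the Gordon–Hedenmalm class. -/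

open scoped ComplexConjugate

theorem tendsto_mean_exp_mul_I {μ : ℝ} (hμ : μ ≠ 0) :
    Tendsto (fun T : ℝ => (T : ℂ)⁻¹ * ∫ t in (0 : ℝ)..T, Complex.exp (μ * Complex.I * t)) atTop
      (nhds 0) := by
  have hc : (μ : ℂ) * Complex.I ≠ 0 := mul_ne_zero (by exact_mod_cast hμ) Complex.I_ne_zero
  refine squeeze_zero_norm' (a := fun T : ℝ => T⁻¹ * (2 / |μ|)) ?_ (by
    simpa using tendsto_inv_atTop_zero.mul_const (2 / |μ|))
  filter_upwards [eventually_gt_atTop 0] with T hT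
  rw [integral_exp_mul_complex hc, norm_mul, norm_inv, Complex.norm_real, Real.norm_of_nonneg hT.le,
    norm_div, norm_mul, Complex.norm_I, Complex.norm_real, mul_one, Real.norm_eq_abs]
  gcongr
  refine (norm_sub_le _ _).trans ?_
  have h : ∀ t : ℝ, ‖Complex.exp (μ * Complex.I * t)‖ = 1 := fun t => by
    rw [show (μ : ℂ) * Complex.I * t = ((μ * t : ℝ) : ℂ) * Complex.I by push_cast; ring,
      Complex.norm_exp_ofReal_mul_I]
  rw [h, h]
  norm_num

/-- The Bessel inequality for trigonometric polynomials in the mean. -/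
theorem sum_norm_sq_le_of_norm_sum_exp_le {ι : Type*} {A : Finset ι} {μ : ι → ℝ}
    (hμ : Set.InjOn μ A) (x : ι → ℂ) {B : ℝ}
    (hB : ∀ t : ℝ, ‖∑ i ∈ A, x i * Complex.exp (μ i * Complex.I * t)‖ ≤ B) :
    ∑ i ∈ A, ‖x i‖ ^ 2 ≤ B ^ 2 := by
  classical
  set S : ℝ → ℂ := fun t => ∑ i ∈ A, x i * Complex.exp (μ i * Complex.I * t) with hS
  have hexp : ∀ t, S t * conj (S t) = ∑ i ∈ A, ∑ j ∈ A,
      (x i * conj (x j)) * Complex.exp ((μ i - μ j : ℝ) * Complex.I * t) := fun t => by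
    rw [hS, map_sum, Finset.sum_mul_sum]
    refine Finset.sum_congr rfl fun i _ => Finset.sum_congr rfl fun j _ => ?_
    rw [map_mul, ← Complex.exp_conj, mul_mul_mul_comm, ← Complex.exp_add]
    simp only [map_mul, Complex.conj_ofReal, Complex.conj_I]
    congr 2
    push_cast
    ring
  have hint : ∀ T : ℝ, (T : ℂ)⁻¹ * ∫ t in (0 : ℝ)..T, S t * conj (S t) = ∑ i ∈ A, ∑ j ∈ A,
      (x i * conj (x j)) * ((T : ℂ)⁻¹ *
        ∫ t in (0 : ℝ)..T, Complex.exp ((μ i - μ j : ℝ) * Complex.I * t)) := fun T => by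
    simp only [hexp]
    rw [intervalIntegral.integral_finsetSum fun i _ => by
      refine Continuous.intervalIntegrable ?_ _ _
      fun_prop]
    rw [Finset.mul_sum]
    refine Finset.sum_congr rfl fun i _ => ?_
    rw [intervalIntegral.integral_finsetSum fun i _ => by
      refine Continuous.intervalIntegrable ?_ _ _
      fun_prop]
    rw [Finset.mul_sum]
    refine Finset.sum_congr rfl fun j _ => ?_
    rw [intervalIntegral.integral_const_mul]
    ring
  have hlim : Tendsto (fun T : ℝ => (T : ℂ)⁻¹ * ∫ t in (0 : ℝ)..T, S t * conj (S t)) atTop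
      (nhds (∑ i ∈ A, ∑ j ∈ A, (x i * conj (x j)) * if i = j then 1 else 0)) := by
    simp only [hint]
    refine tendsto_finsetSum _ fun i hi => tendsto_finsetSum _ fun j hj => ?_
    refine Tendsto.const_mul _ ?_
    by_cases hij : i = j
    · subst hij
      rw [if_pos rfl]
      refine tendsto_const_nhds.congr' ?_
      filter_upwards [eventually_gt_atTop 0] with T hT
      have : (T : ℂ) ≠ 0 := by exact_mod_cast hT.ne'
      simp [this]
    · rw [if_neg hij]
      exact tendsto_mean_exp_mul_I (sub_ne_zero.2 fun h => hij (hμ hi hj h))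
  have hval : (∑ i ∈ A, ∑ j ∈ A, (x i * conj (x j)) * if i = j then (1 : ℂ) else 0) =
      ((∑ i ∈ A, ‖x i‖ ^ 2 : ℝ) : ℂ) := by
    rw [Complex.ofReal_sum]
    refine Finset.sum_congr rfl fun i hi => ?_
    simp only [mul_ite, mul_one, mul_zero]
    rw [Finset.sum_ite_eq, if_pos hi, Complex.mul_conj']
    norm_cast
  rw [hval] at hlim
  have hbound := le_of_tendsto (b := B ^ 2) hlim.norm (by
    filter_upwards [eventually_gt_atTop 0] with T hT
    rw [norm_mul, norm_inv, Complex.norm_real, Real.norm_of_nonneg hT.le, inv_mul_le_iff₀ hT]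
    have := intervalIntegral.norm_integral_le_of_norm_le_const (a := 0) (b := T) (C := B ^ 2)
      (f := fun t => S t * conj (S t)) fun t _ => by
        rw [norm_mul, RCLike.norm_conj, ← sq]
        exact pow_le_pow_left₀ (norm_nonneg _) (hB t) 2
    rwa [sub_zero, abs_of_pos hT, mul_comm] at this)
  rw [Complex.norm_real] at hbound
  exact (le_abs_self _).trans hbound

/-- The tensor power trick: a polynomial factor cannot compensate exponential growth. -/
theorem le_of_forall_pow_le_mul_pow {x y : ℝ} (hy : 0 ≤ y) (D : ℕ)
    (h : ∀ n : ℕ, x ^ n ≤ ((n + 1 : ℕ) : ℝ) ^ D * y ^ n) : x ≤ y := by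
  by_contra hlt
  push Not at hlt
  rcases hy.eq_or_lt with rfl | hy
  · have := h 1
    simp at this
    linarith
  have h1 : 1 < x / y := (one_lt_div hy).2 hlt
  have ht := (tendsto_pow_const_div_const_pow_of_one_lt D h1).comp (tendsto_add_atTop_nat 1)
  obtain ⟨n, hn⟩ := (ht.eventually (gt_mem_nhds (by positivity : 0 < (x / y)⁻¹))).exists
  simp only [Function.comp_apply] at hn
  have h2 := h n
  rw [← div_le_iff₀ (by positivity), ← div_pow] at h2
  rw [div_lt_iff₀ (by positivity), pow_succ, mul_comm, mul_assoc, mul_inv_cancel₀ (by positivity),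
    mul_one] at hn
  linarith

/-- A substitute for Kronecker's theorem. In the `n`-th power of the polynomial all monomials have
distinct frequencies, so Bessel bounds the `ℓ²` norm of the coefficients by `Bⁿ`. There are only
polynomially many of them, so Cauchy–Schwarz bounds their `ℓ¹` norm `(1 + ∑ ‖c_k‖)ⁿ`, and the tensor
power trick removes the loss. -/
theorem one_add_sum_norm_le {d : ℕ} {q : Fin d → ℕ+} (hq : MultiplicativelyIndependent q)
    (c : Fin d → ℂ) {B : ℝ}
    (hB : ∀ t : ℝ, ‖1 + ∑ k, c k * ((q k : ℕ) : ℂ) ^ (-(Complex.I * t))‖ ≤ B) :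
    1 + ∑ k, ‖c k‖ ≤ B := by
  have hB0 : 0 ≤ B := (norm_nonneg _).trans (hB 0)
  have hS0 : 0 ≤ 1 + ∑ k, ‖c k‖ := by positivity
  -- The constant term becomes an extra variable of base `1`. It is invisible in the frequency, but
  -- its exponent is recovered from the total degree `n`.
  set Q : Fin (d + 1) → ℕ+ := Fin.cons 1 q with hQ
  set C : Fin (d + 1) → ℂ := Fin.cons 1 c with hC
  have hCn : ∑ k, ‖C k‖ = 1 + ∑ k, ‖c k‖ := by simp [hC, Fin.sum_univ_succ]
  have hidx : ∀ α : Fin (d + 1) → ℕ, DirichletHardy.monomialIndex Q α =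
      DirichletHardy.monomialIndex q (Fin.tail α) := fun α => by
    simp [DirichletHardy.monomialIndex, hQ, Fin.prod_univ_succ, Fin.tail]
  refine (sq_le_sq₀ hS0 hB0).1 (le_of_forall_pow_le_mul_pow (sq_nonneg _) (d + 1)
    fun n => ?_)
  set A := Finset.piAntidiag (Finset.univ : Finset (Fin (d + 1))) n with hA
  have hinj : Set.InjOn (fun α => -Real.log (DirichletHardy.monomialIndex Q α : ℕ)) A := by
    intro α hα β hβ h
    have h1 : Real.log (DirichletHardy.monomialIndex Q α : ℕ) =
        Real.log (DirichletHardy.monomialIndex Q β : ℕ) := neg_injective h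
    have h2 := Real.log_injOn_pos (by simp) (by simp) h1
    have h3 : DirichletHardy.monomialIndex Q α = DirichletHardy.monomialIndex Q β :=
      PNat.coe_injective (by exact_mod_cast h2)
    rw [hidx, hidx] at h3
    have h4 := DirichletHardy.monomialIndex_injective hq h3
    have h5 := (Finset.mem_piAntidiag.1 hα).1
    have h6 := (Finset.mem_piAntidiag.1 hβ).1
    rw [Fin.sum_univ_succ] at h5 h6
    have h7 : ∀ k : Fin d, α k.succ = β k.succ := fun k => congrFun h4 k
    funext k
    refine Fin.cases ?_ h7 k
    simp only [h7] at h5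
    omega
  have hmean := sum_norm_sq_le_of_norm_sum_exp_le hinj
    (fun α => (Nat.multinomial Finset.univ α : ℂ) * ∏ k, C k ^ α k) (B := B ^ n) fun t => by
      refine le_trans (le_of_eq ?_) (pow_le_pow_left₀ (norm_nonneg _) (hB t) n)
      rw [← norm_pow]
      congr 1
      have h1 : 1 + ∑ k, c k * ((q k : ℕ) : ℂ) ^ (-(Complex.I * t)) =
          ∑ k, C k * ((Q k : ℕ) : ℂ) ^ (-(Complex.I * t)) := by
        simp [hC, hQ, Fin.sum_univ_succ]
      rw [h1, Finset.sum_pow_eq_sum_piAntidiag]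
      refine Finset.sum_congr rfl fun α _ => ?_
      simp only [mul_pow, Finset.prod_mul_distrib]
      rw [← DirichletHardy.monomialIndex_cpow, mul_assoc, Complex.cpow_def_of_ne_zero (by simp),
        ← Complex.natCast_log]
      congr 3
      push_cast
      ring
  have hcard : (A.card : ℝ) ≤ ((n + 1 : ℕ) : ℝ) ^ (d + 1) := by
    have : A ⊆ Fintype.piFinset fun _ : Fin (d + 1) => Finset.range (n + 1) := fun α hα => by
      rw [Fintype.mem_piFinset]
      intro k
      have := (Finset.mem_piAntidiag.1 hα).1
      rw [Finset.mem_range, Nat.lt_succ_iff, ← this]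
      exact Finset.single_le_sum (fun _ _ => Nat.zero_le _) (Finset.mem_univ k)
    have h := Finset.card_le_card this
    rw [Fintype.card_piFinset_const, Finset.card_range] at h
    exact_mod_cast h
  have hcs := sq_sum_le_card_mul_sum_sq (s := A)
    (f := fun α => ‖(Nat.multinomial Finset.univ α : ℂ) * ∏ k, C k ^ α k‖)
  have hsum : ∑ α ∈ A, ‖(Nat.multinomial Finset.univ α : ℂ) * ∏ k, C k ^ α k‖ =
      (1 + ∑ k, ‖c k‖) ^ n := by
    rw [← hCn, Finset.sum_pow_eq_sum_piAntidiag]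
    exact Finset.sum_congr rfl fun α _ => by simp
  rw [hsum] at hcs
  rw [← pow_mul, ← pow_mul, mul_comm 2 n, pow_mul, pow_mul]
  refine hcs.trans (mul_le_mul hcard hmean (by positivity) (by positivity))

/-- By the identity theorem `ψ` equals the Dirichlet polynomial on the whole right half-plane, so by
continuity the polynomial has real part at least `1/2` on the imaginary axis. The bound then follows
from the `ℓ¹` inequality for `1 - w`, where `w` is the nonconstant part. -/
theorem sum_norm_le_of_isGordonHedenmalm {φ : HalfPlane (1 / 2) → HalfPlane (1 / 2)}
    (hG : IsGordonHedenmalm 0 φ) {a : ℂ} {d : ℕ} {q : Fin d → ℕ+} {c : Fin d → ℂ}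
    (hq : MultiplicativelyIndependent q)
    (hφ : ∀ s, (φ s : ℂ) = a + ∑ k, c k * ((q k : ℕ) : ℂ) ^ (-(s : ℂ))) :
    ∑ k, ‖c k‖ ≤ a.re - 1 / 2 := by
  obtain ⟨b, ψ, hunif, hψφ, hmap, -⟩ := hG
  set U : Set ℂ := {s | 0 < s.re} with hU
  have hUo : IsOpen U := isOpen_lt continuous_const Complex.continuous_re
  set g : ℂ → ℂ := fun s => a + ∑ k, c k * ((q k : ℕ) : ℂ) ^ (-s) with hg
  have hterm : ∀ n : ℕ+, Differentiable ℂ fun s : ℂ => ((n : ℕ) : ℂ) ^ (-s) := fun n s =>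
    (differentiableAt_id.neg).const_cpow (Or.inl (by simp))
  have hgd : Differentiable ℂ g := by
    refine (differentiable_const a).add (Differentiable.fun_sum fun k _ => ?_)
    exact (hterm (q k)).const_mul (c k)
  have hloc : TendstoLocallyUniformlyOn
      (fun (M : ℕ) (s : ℂ) => ∑ n ∈ Finset.Icc 1 M, b n * (n : ℂ) ^ (-s)) ψ atTop U := by
    refine tendstoLocallyUniformlyOn_of_forall_exists_nhds fun s hs => ?_
    have hs' : s.re / 2 < s.re := half_lt_self hs
    exact ⟨_, mem_nhdsWithin_of_mem_nhds
      ((isOpen_lt continuous_const Complex.continuous_re).mem_nhds hs'),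
      hunif (s.re / 2) (half_pos hs)⟩
  have hψd : DifferentiableOn ℂ ψ U := by
    refine hloc.differentiableOn (Eventually.of_forall fun M => ?_) hUo
    refine Differentiable.differentiableOn (Differentiable.fun_sum fun n hn => ?_)
    exact (hterm ⟨n, (Finset.mem_Icc.1 hn).1⟩).const_mul (b n)
  have heq : Set.EqOn ψ g U := by
    refine (hψd.analyticOnNhd hUo).eqOn_of_preconnected_of_eventuallyEq
      (hgd.differentiableOn.analyticOnNhd hUo) (convex_halfSpace_re_gt 0).isPreconnected
      (z₀ := 1) (by simp [hU]) ?_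
    have h1 : {s : ℂ | 1 / 2 < s.re} ∈ nhds (1 : ℂ) :=
      (isOpen_lt continuous_const Complex.continuous_re).mem_nhds (by norm_num)
    filter_upwards [h1] with s hs
    have h2 := hψφ ⟨s, hs⟩
    rw [hφ] at h2
    simpa [hg] using h2.symm
  have hre : ∀ t : ℝ, 1 / 2 ≤ (g (Complex.I * t)).re := fun t => by
    have hlim : Tendsto (fun σ : ℝ => (g (σ + Complex.I * t)).re) (nhdsWithin 0 (Set.Ioi 0))
        (nhds (g (Complex.I * t)).re) := by
      have : Continuous fun σ : ℝ => (g (σ + Complex.I * t)).re := by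
        have := hgd.continuous
        fun_prop
      have h := this.tendsto 0
      rw [Complex.ofReal_zero, zero_add] at h
      exact h.mono_left nhdsWithin_le_nhds
    refine ge_of_tendsto hlim ?_
    filter_upwards [self_mem_nhdsWithin] with σ hσ
    have hmem : (σ + Complex.I * t : ℂ) ∈ U := by simpa [hU] using hσ
    rw [← heq hmem]
    exact (hmap rfl _ hmem).le
  set S := ∑ k, ‖c k‖ with hS
  -- With `S = ∑ ‖c_k‖`, `‖1 - w‖² = 1 - 2 Re w + ‖w‖²` is at most `1 + 2 (Re a - 1/2) + S²`.
  -- Comparing with `(1 + S)²`, the squares cancel and leave `S ≤ Re a - 1/2`.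
  have hb : ∀ t : ℝ, ‖1 + ∑ k, -c k * ((q k : ℕ) : ℂ) ^ (-(Complex.I * t))‖ ≤
      √(1 + 2 * (a.re - 1 / 2) + S ^ 2) := fun t => by
    refine Real.le_sqrt_of_sq_le ?_
    set w := ∑ k, c k * ((q k : ℕ) : ℂ) ^ (-(Complex.I * t)) with hw
    have h1 : ∑ k, -c k * ((q k : ℕ) : ℂ) ^ (-(Complex.I * t)) = -w := by
      simp [hw, Finset.sum_neg_distrib]
    have h2 : ‖w‖ ≤ S := by
      refine (norm_sum_le _ _).trans (Finset.sum_le_sum fun k _ => ?_)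
      rw [norm_mul, Complex.norm_natCast_cpow_of_pos (q k).pos]
      simp
    have h3 : 1 / 2 ≤ a.re + w.re := by
      rw [← Complex.add_re]
      exact hre t
    have h4 : ‖w‖ ^ 2 ≤ S ^ 2 := pow_le_pow_left₀ (norm_nonneg _) h2 2
    rw [h1]
    rw [← Complex.normSq_eq_norm_sq, Complex.normSq_apply] at h4 ⊢
    simp only [Complex.add_re, Complex.add_im, Complex.one_re, Complex.one_im, Complex.neg_re,
      Complex.neg_im]
    nlinarith
  have hfin := one_add_sum_norm_le hq (fun k => -c k) hb
  simp only [norm_neg] at hfin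
  have hS0 : 0 ≤ S := by positivity
  have hnn : 0 ≤ 1 + 2 * (a.re - 1 / 2) + S ^ 2 := by
    by_contra hneg
    rw [Real.sqrt_eq_zero_of_nonpos (by linarith)] at hfin
    linarith
  have := (Real.le_sqrt' (by positivity)).1 hfin
  nlinarith

/-! ### Functionals supported on the powers of one integer. -/

/-- Every integer `q₀ ≥ 2` is a power of some `Q` such that any integer having a power in common
with `Q` is itself a power of `Q`. -/
theorem exists_pow_root (q₀ : ℕ+) (hq₀ : q₀ ≠ 1) :
    ∃ (Q : ℕ+) (m₀ : ℕ), Q ≠ 1 ∧ 1 ≤ m₀ ∧ q₀ = Q ^ m₀ ∧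
      ∀ q : ℕ+, q ≠ 1 → (∃ k, 1 ≤ k ∧ q = Q ^ k) ∨ ∀ l m : ℕ, 1 ≤ l → q ^ l ≠ Q ^ m := by
  classical
  have hlt : ∀ (P : ℕ+) (m : ℕ), P ≠ 1 → P ^ m = q₀ → m ≤ q₀ := fun P m hP h => by
    have h2 : 1 < (P : ℕ) := by
      have := P.pos
      have : (P : ℕ) ≠ 1 := fun h => hP (PNat.coe_eq_one_iff.1 h)
      omega
    have := Nat.lt_pow_self (n := m) h2
    rw [← h, PNat.pow_coe]
    exact this.le
  -- `Q` is the root of `q₀` of largest exponent. A relation `q ^ l = Q ^ m` writes `q` and `Q` as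
  -- powers of a common `B`, and maximality forces `Q = B`.
  let p : ℕ → Prop := fun m => ∃ P : ℕ+, P ≠ 1 ∧ P ^ m = q₀
  have hp1 : p 1 := ⟨q₀, hq₀, pow_one _⟩
  have hle : 1 ≤ (q₀ : ℕ) := q₀.pos
  obtain ⟨Q, hQ1, hQ⟩ : p (Nat.findGreatest p q₀) := Nat.findGreatest_spec hle hp1
  set m₀ := Nat.findGreatest p q₀ with hm₀
  have hm₀1 : 1 ≤ m₀ := Nat.le_findGreatest hle hp1
  refine ⟨Q, m₀, hQ1, hm₀1, hQ.symm, fun q hq => ?_⟩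
  by_contra hcon
  push Not at hcon
  obtain ⟨hcon1, l, m, hl, hlm⟩ := hcon
  have hnat : (q : ℕ) ^ l = (Q : ℕ) ^ m := by exact_mod_cast congrArg PNat.val hlm
  obtain ⟨b, hb1, hb2⟩ := Nat.exists_eq_pow_of_pow_eq_pow (Or.inl (by omega : l ≠ 0)) hnat
  set g := Nat.gcd l m
  have hbpos : 0 < b := by
    rcases Nat.eq_zero_or_pos b with rfl | h
    · have h0 : l / g ≠ 0 :=
        (Nat.div_pos (Nat.gcd_le_left m hl) (Nat.gcd_pos_of_pos_left m hl)).ne'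
      rw [zero_pow h0] at hb2
      exact absurd hb2 Q.ne_zero
    · exact h
  obtain ⟨B, rfl⟩ : ∃ B : ℕ+, (B : ℕ) = b := ⟨⟨b, hbpos⟩, rfl⟩
  have hb2' : Q = B ^ (l / g) := PNat.coe_injective (by rw [PNat.pow_coe]; exact hb2)
  have hb1' : q = B ^ (m / g) := PNat.coe_injective (by rw [PNat.pow_coe]; exact hb1)
  have hbne : B ≠ 1 := fun h => hQ1 (by rw [hb2', h, one_pow])
  have hpm : p (l / g * m₀) := ⟨_, hbne, by rw [pow_mul, ← hb2', hQ]⟩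
  have h1 : l / g * m₀ ≤ m₀ := by
    obtain ⟨P, hP1, hP⟩ := hpm
    exact Nat.le_findGreatest (hlt P _ hP1 hP) ⟨P, hP1, hP⟩
  have h2 : 1 ≤ l / g := Nat.div_pos (Nat.gcd_le_left m hl) (Nat.gcd_pos_of_pos_left m hl)
  have h3 : l / g = 1 := by nlinarith
  rw [h3, pow_one] at hb2'
  rw [← hb2'] at hb1'
  refine hcon1 (m / g) ?_ hb1'
  by_contra h0
  rw [Nat.lt_one_iff.1 (not_le.1 h0), pow_zero] at hb1'
  exact hq hb1'

namespace DirichletHardy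

open scoped InnerProductSpace ComplexConjugate

/-- The kernel of the evaluation `f ↦ ∑ f(Qᵐ) zᵐ`. -/
theorem exists_powerKernel {Q : ℕ+} (hQ : Q ≠ 1) {z : ℂ} (hz : ‖z‖ < 1) :
    ∃ e : DirichletHardy, ‖e‖ ^ 2 ≤ (1 - ‖z‖ ^ 2)⁻¹ ∧
      (∀ m : ℕ, ⟪e, lp.single 2 (Q ^ m) (1 : ℂ)⟫_ℂ = z ^ m) ∧
      ∀ n : ℕ+, (∀ m : ℕ, n ≠ Q ^ m) → ⟪e, lp.single 2 n (1 : ℂ)⟫_ℂ = 0 := by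
  have hQlt : 1 < (Q : ℕ) := by
    have := Q.pos
    have : (Q : ℕ) ≠ 1 := fun h => hQ (PNat.coe_eq_one_iff.1 h)
    omega
  have hinj : ∀ {i j : ℕ}, Q ^ i = Q ^ j → i = j := fun {i j} h => by
    have : (Q : ℕ) ^ i = (Q : ℕ) ^ j := by exact_mod_cast congrArg PNat.val h
    exact Nat.pow_right_injective hQlt this
  have hz2 : ‖z‖ ^ 2 < 1 := by
    rw [sq_lt_one_iff₀ (norm_nonneg _)]; exact hz
  have hgeom := hasSum_geometric_of_lt_one (sq_nonneg ‖z‖) hz2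
  have hsum := summable_smul_of_orthogonal
    (v := fun m => (lp.single 2 (Q ^ m) (1 : ℂ) : DirichletHardy))
    (fun i j hij => by beta_reduce; rw [inner_single_single, if_neg fun h => hij (hinj h)])
    (B := 1) (C := (1 - ‖z‖ ^ 2)⁻¹) (fun m => by rw [lp.norm_single (by norm_num)]; simp)
    (x := fun m => conj z ^ m) (fun s => by
      refine (le_of_eq (Finset.sum_congr rfl fun m _ => ?_)).trans
        (sum_le_hasSum s (fun m _ => by positivity) hgeom)
      rw [norm_pow, RCLike.norm_conj, ← pow_mul, ← pow_mul, mul_comm])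
  refine ⟨_, hsum.2.trans_eq (by ring), fun m => ?_, fun n hn => ?_⟩
  · have h := hsum.1.hasSum.mapL (innerSL ℂ (lp.single 2 (Q ^ m) (1 : ℂ) : DirichletHardy))
    simp only [innerSL_apply_apply, inner_smul_right, inner_single_single] at h
    rw [← inner_conj_symm, ← h.tsum_eq, tsum_eq_single m]
    · simp
    · intro j hj
      rw [if_neg fun h => hj (hinj h).symm, mul_zero]
  · have h := hsum.1.hasSum.mapL (innerSL ℂ (lp.single 2 n (1 : ℂ) : DirichletHardy))
    simp only [innerSL_apply_apply, inner_smul_right, inner_single_single, hn, if_false, mul_zero] at h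
    rw [← inner_conj_symm, h.unique hasSum_zero, map_zero]

theorem powVec_const_one (q : ℕ+) (x : ℂ) (m : ℕ) :
    powVec (fun _ : Fin 1 => q) (fun _ => x) m = x ^ m • lp.single 2 (q ^ m) (1 : ℂ) := by
  refine toFunction_injective (funext fun s => ?_)
  have h : (((q ^ m : ℕ+) : ℕ) : ℂ) ^ (-(s : ℂ)) = (((q : ℕ) : ℂ) ^ (-(s : ℂ))) ^ m := by
    simpa [monomialIndex] using monomialIndex_cpow (fun _ : Fin 1 => q) (fun _ => m) (-(s : ℂ))
  rw [toFunction_powVec, map_smul, Pi.smul_apply, toFunction_single, h]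
  simp [mul_pow]

/-- Pairing with `e` turns the powers of `c q⁻ˢ` into powers of `w`, so the expansion of `T f`
becomes the Taylor series of `f` at `a` evaluated at `a + w`. -/
theorem inner_operator_eq {a : ℂ} (ha : 1 / 2 < a.re) {q : ℕ+} {c : ℂ}
    {T : DirichletHardy →L[ℂ] DirichletHardy}
    (hT : ∀ f, HasSum (fun m => taylorCoeff a ha m f •
        powVec (fun _ : Fin 1 => q) (fun _ => c / ((a.re - 1 / 2 : ℝ) : ℂ)) m) (T f))
    {e : DirichletHardy} {w : ℂ} (hw : ‖w‖ < a.re - 1 / 2)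
    (he : ∀ m : ℕ, c ^ m * ⟪e, lp.single 2 (q ^ m) (1 : ℂ)⟫_ℂ = w ^ m) (f : DirichletHardy)
    (s : HalfPlane (1 / 2)) (hs : (s : ℂ) = a + w) : ⟪e, T f⟫_ℂ = toFunction f s := by
  have h := (hT f).mapL (innerSL ℂ e)
  refine h.unique ((hasSum_taylorCoeff ha hw f s hs).congr_fun fun m => ?_)
  rw [innerSL_apply_apply, inner_smul_right, powVec_const_one, inner_smul_right, div_pow, div_pow,
    div_mul_eq_mul_div, he]

/-- The images stay in a compact set, and any cluster point vanishes at every `s` because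
evaluations are continuous; so `0` is the only possible cluster point. -/
theorem tendsto_zero_of_isCompactOperator {ι : Type*} {l : Filter ι}
    {T : DirichletHardy →L[ℂ] DirichletHardy} (hT : IsCompactOperator T) {g : ι → DirichletHardy}
    {M : ℝ} (hg : ∀ᶠ i in l, ‖g i‖ ≤ M)
    (hlim : ∀ s, Tendsto (fun i => toFunction (T (g i)) s) l (nhds 0)) :
    Tendsto (fun i => T (g i)) l (nhds 0) := by
  have hK := hT.isCompact_closure_image_closedBall (f := (T : DirichletHardy →ₗ[ℂ] DirichletHardy)) M
  refine hK.tendsto_nhds_of_unique_mapClusterPt ?_ fun y _ hy => ?_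
  · filter_upwards [hg] with i hi
    exact subset_closure ⟨g i, by simpa using hi, rfl⟩
  · refine toFunction_injective (funext fun s => ?_)
    have h1 : MapClusterPt (toFunction y s) l fun i => toFunction (T (g i)) s :=
      hy.continuousAt_comp (continuous_toFunction_apply s).continuousAt
    rw [map_zero, Pi.zero_apply]
    by_contra hne
    obtain ⟨u, v, hu, hv, hyu, h0v, hd⟩ := t2_separation hne
    have h2 := h1.frequently (hu.mem_nhds hyu)
    have h3 := hlim s (hv.mem_nhds h0v)
    obtain ⟨i, hi1, hi2⟩ := (h2.and_eventually h3).exists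
    exact Set.disjoint_left.1 hd hi1 hi2

end DirichletHardy

/-! ### Simple fractions and the pole of zeta along parabolas. -/

/-- Linear independence of simple fractions with distinct poles. -/
theorem eq_zero_of_sum_div_eq_zero {ι : Type*} [DecidableEq ι] {A : Finset ι} {x : ι → ℂ}
    {p : ι → ℝ} (hp : Set.InjOn p A) (hp0 : ∀ i ∈ A, 0 ≤ p i)
    (h : ∀ y : ℝ, 0 < y → ∑ i ∈ A, x i * ((y + p i : ℝ) : ℂ)⁻¹ = 0) : ∀ i ∈ A, x i = 0 := by
  intro i hi
  let P : Polynomial ℂ := ∑ j ∈ A, Polynomial.C (x j) *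
    ∏ k ∈ A.erase j, (Polynomial.X + Polynomial.C ((p k : ℝ) : ℂ))
  have heval : ∀ w : ℂ, P.eval w = ∑ j ∈ A, x j * ∏ k ∈ A.erase j, (w + p k) := fun w => by
    simp [P, Polynomial.eval_finsetSum, Polynomial.eval_prod]
  have hP : P = 0 := by
    refine Polynomial.eq_zero_of_infinite_isRoot P (Set.Infinite.mono
      (s := (fun y : ℝ => (y : ℂ)) '' Set.Ioi 0) ?_
      ((Set.Ioi_infinite 0).image Complex.ofReal_injective.injOn))
    rintro _ ⟨y, hy, rfl⟩
    have hy : 0 < y := hy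
    change P.eval _ = 0
    rw [heval]
    have hne : ∀ k ∈ A, ((y : ℂ) + p k) ≠ 0 := fun k hk => by
      have := hp0 k hk
      exact_mod_cast (by linarith : y + p k ≠ 0)
    have h1 : ∑ j ∈ A, x j * ∏ k ∈ A.erase j, ((y : ℂ) + p k) =
        (∏ k ∈ A, ((y : ℂ) + p k)) * ∑ j ∈ A, x j * ((y + p j : ℝ) : ℂ)⁻¹ := by
      rw [Finset.mul_sum]
      refine Finset.sum_congr rfl fun j hj => ?_
      rw [← Finset.mul_prod_erase A _ hj]
      have := hne j hj
      push_cast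
      field_simp
    rw [h1, h y hy, mul_zero]
  have h2 := heval (-(p i : ℝ))
  rw [hP, Polynomial.eval_zero, Finset.sum_eq_single i] at h2
  · refine (mul_eq_zero.1 h2.symm).resolve_right (Finset.prod_ne_zero_iff.2 fun k hk => ?_)
    rw [neg_add_eq_sub, sub_ne_zero]
    exact fun h => Finset.ne_of_mem_erase hk
      (hp (Finset.mem_of_mem_erase hk) hi (Complex.ofReal_injective h))
  · intro j _ hji
    rw [Finset.prod_eq_zero (Finset.mem_erase.2 ⟨hji.symm, hi⟩) (by ring), mul_zero]
  · exact fun h => absurd hi h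

theorem tendsto_mul_riemannZeta_of_ne {ι : Type*} {l : Filter ι} {ε E : ι → ℂ} {e : ℂ}
    (hε : Tendsto ε l (nhds 0)) (hE : Tendsto E l (nhds e)) (he : e ≠ 0) :
    Tendsto (fun i => ε i * riemannZeta (1 + E i)) l (nhds 0) := by
  have h := (differentiableAt_riemannZeta (s := 1 + e) (by simpa using he)).continuousAt.tendsto.comp
    (hE.const_add 1)
  simpa using hε.mul h

theorem tendsto_mul_riemannZeta_of_zero {ι : Type*} {l : Filter ι} {ε E : ι → ℂ} {L : ℂ}
    (hE : Tendsto E l (nhds 0)) (hE0 : ∀ᶠ i in l, E i ≠ 0)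
    (hL : Tendsto (fun i => ε i / E i) l (nhds L)) :
    Tendsto (fun i => ε i * riemannZeta (1 + E i)) l (nhds L) := by
  have h1 : Tendsto (fun i => 1 + E i) l (nhdsWithin 1 {1}ᶜ) := by
    refine tendsto_nhdsWithin_iff.2 ⟨by simpa using hE.const_add 1, ?_⟩
    filter_upwards [hE0] with i hi
    simpa using hi
  have h2 := hL.mul (riemannZeta_residue_one.comp h1)
  rw [mul_one] at h2
  refine h2.congr' ?_
  filter_upwards [hE0] with i hi
  simp only [Function.comp_apply, add_sub_cancel_left]
  field_simp

/-- Second order expansion of `exp` along the parabola `m (i θ - θ²)`. -/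
theorem tendsto_exp_parabola (m : ℕ) :
    Tendsto (fun θ : ℝ => (Complex.exp (m * (Complex.I * θ - θ ^ 2)) - 1 - m * (Complex.I * θ)) /
      (θ : ℂ) ^ 2) (nhdsWithin 0 (Set.Ioi 0)) (nhds (-((m : ℂ) + m ^ 2 / 2))) := by
  set v : ℝ → ℂ := fun θ => m * (Complex.I * θ - θ ^ 2) with hv
  have hvc : Tendsto v (nhdsWithin 0 (Set.Ioi 0)) (nhds 0) := by
    have : Continuous v := by fun_prop
    have h := this.tendsto 0
    simp only [hv, Complex.ofReal_zero] at h
    simp only [mul_zero, ne_eq, OfNat.ofNat_ne_zero, not_false_eq_true, zero_pow, sub_zero] at h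
    exact h.mono_left nhdsWithin_le_nhds
  have hu : Tendsto (fun θ : ℝ => (m : ℂ) * (Complex.I - θ)) (nhdsWithin 0 (Set.Ioi 0))
      (nhds (m * Complex.I)) := by
    have : Continuous fun θ : ℝ => (m : ℂ) * (Complex.I - θ) := by fun_prop
    have h := this.tendsto 0
    simp only [Complex.ofReal_zero, sub_zero] at h
    exact h.mono_left nhdsWithin_le_nhds
  have hrem : Tendsto (fun θ : ℝ => (Complex.exp (v θ) - 1 - v θ - v θ ^ 2 / 2) / (θ : ℂ) ^ 2)
      (nhdsWithin 0 (Set.Ioi 0)) (nhds 0) := by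
    refine squeeze_zero_norm' (a := fun θ : ℝ => ‖(m : ℂ) * (Complex.I - θ)‖ ^ 2 * ‖v θ‖) ?_ (by
      simpa using (hu.norm.pow 2).mul hvc.norm)
    filter_upwards [self_mem_nhdsWithin, hvc.norm.eventually (ge_mem_nhds (by simp : ‖(0 : ℂ)‖ < 1))]
      with θ hθ hle
    have hθ : 0 < θ := hθ
    have hb := Complex.exp_bound hle (n := 3) (by norm_num)
    simp only [Finset.sum_range_succ, Finset.sum_range_zero] at hb
    norm_num at hb
    have hb' : ‖Complex.exp (v θ) - 1 - v θ - v θ ^ 2 / 2‖ ≤ ‖v θ‖ ^ 3 := by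
      rw [show Complex.exp (v θ) - 1 - v θ - v θ ^ 2 / 2 =
        Complex.exp (v θ) - (1 + v θ + v θ ^ 2 / 2) by ring]
      refine hb.trans ?_
      have : 0 ≤ ‖v θ‖ ^ 3 := by positivity
      linarith
    have hve : v θ = θ * (m * (Complex.I - θ)) := by rw [hv]; ring
    rw [norm_div, norm_pow, Complex.norm_real, Real.norm_of_nonneg hθ.le, div_le_iff₀ (by positivity)]
    refine hb'.trans (le_of_eq ?_)
    have : ‖v θ‖ = θ * ‖(m : ℂ) * (Complex.I - θ)‖ := by
      rw [hve, norm_mul, Complex.norm_real, Real.norm_of_nonneg hθ.le]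
    rw [this]
    ring
  have h2 := (hrem.add ((hu.pow 2).div_const 2)).add_const (-(m : ℂ))
  have hval : 0 + (↑m * Complex.I) ^ 2 / 2 + -(m : ℂ) = -(m + m ^ 2 / 2) := by
    rw [mul_pow, Complex.I_sq]; ring
  rw [hval] at h2
  refine h2.congr' ?_
  filter_upwards [self_mem_nhdsWithin] with θ hθ
  have hθ : (θ : ℂ) ≠ 0 := by exact_mod_cast (ne_of_gt hθ : θ ≠ 0)
  field_simp
  simp only [hv]
  ring_nf

/-- The value `c zᵏ`, read as `0` when `k = 0`. -/
noncomputable def positivePower (c : ℂ) (k : ℕ) (z : ℂ) : ℂ := if k = 0 then 0 else c * z ^ k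

theorem continuous_positivePower (c : ℂ) (k : ℕ) : Continuous (positivePower c k) := by
  unfold positivePower
  split_ifs <;> fun_prop

theorem norm_positivePower_le (c : ℂ) (k : ℕ) {z : ℂ} (hz : ‖z‖ ≤ 1) :
    ‖positivePower c k z‖ ≤ ‖c‖ * ‖z‖ := by
  unfold positivePower
  split_ifs with hk
  · rw [norm_zero]; positivity
  · rw [norm_mul, norm_pow]
    exact mul_le_mul_of_nonneg_left (pow_le_of_le_one (norm_nonneg _) hz hk) (norm_nonneg _)

theorem norm_exp_I_mul_sub_sq (θ : ℝ) :
    ‖Complex.exp (Complex.I * θ - θ ^ 2)‖ = Real.exp (-θ ^ 2) := by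
  rw [Complex.norm_exp]
  congr 1
  simp [← Complex.ofReal_pow]

open Classical in
/-- Boundary behaviour of a zeta kernel along a disc touching the critical line. -/
theorem tendsto_sq_mul_riemannZeta_parabola {a c z₀ : ℂ} {k : ℕ} (hz₀ : ‖z₀‖ = 1)
    (hr : ‖c‖ = a.re - 1 / 2) (ha : 1 / 2 < a.re) {τ x₀ y : ℝ} (hy : 0 < y) :
    Tendsto (fun θ : ℝ => (θ : ℂ) ^ 2 * riemannZeta ((1 / 2 - Complex.I * τ + Complex.I * x₀ * θ +
        y * θ ^ 2) + (a + positivePower c k (z₀ * Complex.exp (Complex.I * θ - θ ^ 2)))))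
      (nhdsWithin 0 (Set.Ioi 0))
      (nhds (if a - 1 / 2 - Complex.I * τ + positivePower c k z₀ = 0 ∧ (a.re - 1 / 2) * k = x₀ then
        ((y + (a.re - 1 / 2) * (k + k ^ 2 / 2) : ℝ) : ℂ)⁻¹ else 0)) := by
  set e := a - 1 / 2 - Complex.I * τ + positivePower c k z₀ with he
  set E : ℝ → ℂ := fun θ => -1 / 2 - Complex.I * τ + Complex.I * x₀ * θ + y * θ ^ 2 + a +
    positivePower c k (z₀ * Complex.exp (Complex.I * θ - θ ^ 2)) with hE
  have hcongr : ∀ θ : ℝ, (1 / 2 - Complex.I * τ + Complex.I * x₀ * θ + y * θ ^ 2) +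
      (a + positivePower c k (z₀ * Complex.exp (Complex.I * θ - θ ^ 2))) = 1 + E θ := fun θ => by
    rw [hE]; ring
  simp only [hcongr]
  have hEc : Tendsto E (nhdsWithin 0 (Set.Ioi 0)) (nhds e) := by
    have hc : Continuous E := by
      have := continuous_positivePower c k
      fun_prop
    have h := hc.tendsto 0
    have h0 : E 0 = e := by
      simp only [hE, he]
      simp
      ring
    rw [h0] at h
    exact h.mono_left nhdsWithin_le_nhds
  have hid : Tendsto (fun θ : ℝ => (θ : ℂ)) (nhdsWithin 0 (Set.Ioi 0)) (nhds 0) := by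
    have h := Complex.continuous_ofReal.tendsto 0
    rw [Complex.ofReal_zero] at h
    exact h.mono_left nhdsWithin_le_nhds
  by_cases he0 : e = 0
  swap
  · rw [if_neg fun h => he0 h.1]
    refine tendsto_mul_riemannZeta_of_ne ?_ hEc he0
    simpa using hid.pow 2
  set r := a.re - 1 / 2 with hrdef
  have hr0 : 0 < r := by rw [hrdef]; linarith
  -- For `k = 0` the real part of `e` would be `Re a - 1/2 > 0`.
  have hk : k ≠ 0 := by
    rintro rfl
    have := congrArg Complex.re he0
    simp [he, positivePower] at this
    linarith
  have hpp : ∀ z, positivePower c k z = c * z ^ k := fun z => by rw [positivePower, if_neg hk]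
  have hcz : c * z₀ ^ k = -(a - 1 / 2 - Complex.I * τ) := by
    rw [he, hpp] at he0
    linear_combination he0
  -- The circle of radius `r` about `a` is tangent to the critical line, so it meets it only at
  -- height `Im a`.
  have him : a.im = τ := by
    have h1 : ‖a - 1 / 2 - Complex.I * τ‖ = r := by
      rw [← norm_neg, ← hcz, norm_mul, norm_pow, hz₀, one_pow, mul_one, hr]
    have h2 : (a - 1 / 2 - Complex.I * τ).re = r := by simp [hrdef]
    have h3 : (a - 1 / 2 - Complex.I * τ).im = a.im - τ := by simp
    have h4 := Complex.sq_norm (a - 1 / 2 - Complex.I * τ)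
    rw [h1, Complex.normSq_apply, h2, h3] at h4
    have : (a.im - τ) * (a.im - τ) = 0 := by linarith
    linarith [mul_self_eq_zero.1 this]
  have hadef : a = 1 / 2 + r + Complex.I * τ := by
    apply Complex.ext
    · simp [hrdef]
    · simp [him]
  have hcr : c * z₀ ^ k = -r := by rw [hcz, hadef]; ring
  have hEeq : ∀ θ : ℝ, E θ = Complex.I * x₀ * θ + y * θ ^ 2 + r -
      r * Complex.exp (k * (Complex.I * θ - θ ^ 2)) := fun θ => by
    simp only [hE]
    rw [hpp, mul_pow, ← Complex.exp_nat_mul, ← mul_assoc, hcr, hadef]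
    ring
  have hE0 : ∀ᶠ θ in nhdsWithin (0 : ℝ) (Set.Ioi 0), E θ ≠ 0 := by
    filter_upwards [self_mem_nhdsWithin] with θ hθ h
    have hθ : 0 < θ := hθ
    have h1 := congrArg Complex.re h
    rw [hEeq] at h1
    have h2 : (Complex.exp (k * (Complex.I * θ - θ ^ 2))).re ≤ 1 := by
      refine (Complex.re_le_norm _).trans ?_
      rw [Complex.exp_nat_mul, norm_pow, norm_exp_I_mul_sub_sq]
      exact pow_le_one₀ (Real.exp_nonneg _) (Real.exp_le_one_iff.2 (by nlinarith))
    simp only [Complex.add_re, Complex.sub_re, Complex.re_ofReal_mul, Complex.ofReal_re,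
      ← Complex.ofReal_pow, ← Complex.ofReal_mul, mul_assoc, Complex.I_mul_re, Complex.ofReal_im,
      Complex.zero_re] at h1
    have h3 : 0 < y * θ ^ 2 := by positivity
    have h4 : r * (Complex.exp (k * (Complex.I * θ - θ ^ 2))).re ≤ r :=
      mul_le_of_le_one_right hr0.le h2
    simp only [← Complex.ofReal_pow] at h4
    linarith
  set R : ℝ → ℂ := fun θ => (Complex.exp (k * (Complex.I * θ - θ ^ 2)) - 1 - k * (Complex.I * θ)) /
      (θ : ℂ) ^ 2 with hR
  have hRlim : Tendsto (fun θ => y - r * R θ) (nhdsWithin 0 (Set.Ioi 0))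
      (nhds ((y + r * (k + k ^ 2 / 2) : ℝ) : ℂ)) := by
    have := (((tendsto_exp_parabola k).const_mul (r : ℂ)).const_sub (y : ℂ))
    convert this using 2
    push_cast
    ring
  -- The first-order term is `i (x₀ - r k) θ`. If it is nonzero, `E` is only of order `θ` and `θ² /
  -- E → 0`; if it vanishes, the second-order coefficient determines the limit.
  have hER : ∀ θ : ℝ, 0 < θ → E θ = θ * (Complex.I * (x₀ - r * k) + θ * (y - r * R θ)) :=
    fun θ hθ => by
      have : (θ : ℂ) ≠ 0 := by exact_mod_cast hθ.ne'
      rw [hEeq]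
      simp only [hR]
      field_simp
      ring
  refine tendsto_mul_riemannZeta_of_zero (he0 ▸ hEc) hE0 ?_
  by_cases hx : r * k = x₀
  · rw [if_pos ⟨he0, hx⟩]
    have hne : ((y + r * (k + k ^ 2 / 2) : ℝ) : ℂ) ≠ 0 := by
      have : 0 < y + r * (k + k ^ 2 / 2) := by positivity
      exact_mod_cast this.ne'
    refine (hRlim.inv₀ hne).congr' ?_
    filter_upwards [self_mem_nhdsWithin] with θ hθ
    have hθ : 0 < θ := hθ
    have h1 : (θ : ℂ) ≠ 0 := by exact_mod_cast hθ.ne'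
    rw [hER θ hθ, ← hx]
    push_cast
    rw [sub_self, mul_zero, zero_add, ← mul_assoc, ← sq, div_mul_eq_div_div,
      div_self (pow_ne_zero 2 h1), one_div]
  · rw [if_neg fun h => hx h.2]
    have hden : Tendsto (fun θ : ℝ => Complex.I * (x₀ - r * k) + θ * (y - r * R θ))
        (nhdsWithin 0 (Set.Ioi 0)) (nhds (Complex.I * (x₀ - r * k))) := by
      simpa using (hid.mul hRlim).const_add (Complex.I * (x₀ - r * k) : ℂ)
    have hne : Complex.I * ((x₀ : ℂ) - r * k) ≠ 0 := by
      refine mul_ne_zero Complex.I_ne_zero (sub_ne_zero.2 ?_)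
      exact_mod_cast fun h : x₀ = r * k => hx h.symm
    have h := hid.div hden hne
    rw [zero_div] at h
    refine h.congr' ?_
    filter_upwards [self_mem_nhdsWithin] with θ hθ
    have hθ : 0 < θ := hθ
    have h1 : (θ : ℂ) ≠ 0 := by exact_mod_cast hθ.ne'
    rw [Pi.div_apply, hER θ hθ, sq, mul_div_mul_left _ _ h1]

theorem sq_mul_inv_one_sub_exp_le {θ : ℝ} (hθ : 0 < θ) (hθ1 : θ ≤ 1) :
    θ ^ 2 * (1 - Real.exp (-θ ^ 2) ^ 2)⁻¹ ≤ 3 / 2 := by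
  have h1 : Real.exp (-θ ^ 2) ^ 2 ≤ (1 + 2 * θ ^ 2)⁻¹ := by
    rw [← Real.exp_nat_mul, show ((2 : ℕ) : ℝ) * -θ ^ 2 = -(2 * θ ^ 2) by push_cast; ring,
      Real.exp_neg]
    refine inv_anti₀ (by positivity) ?_
    rw [add_comm]
    exact Real.add_one_le_exp _
  have h2 : (1 + 2 * θ ^ 2)⁻¹ = 1 - 2 * θ ^ 2 / (1 + 2 * θ ^ 2) := by field_simp; ring
  have h3 : 2 * θ ^ 2 / (1 + 2 * θ ^ 2) ≤ 1 - Real.exp (-θ ^ 2) ^ 2 := by linarith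
  refine (mul_le_mul_of_nonneg_left (inv_anti₀ (by positivity) h3) (sq_nonneg θ)).trans ?_
  have h4 : θ ^ 2 ≤ 1 := pow_le_one₀ hθ.le hθ1
  rw [inv_div, show θ ^ 2 * ((1 + 2 * θ ^ 2) / (2 * θ ^ 2)) = (1 + 2 * θ ^ 2) / 2 by field_simp]
  linarith

/-! ### Noncompactness of combinations of touching symbols. -/

namespace DirichletHardy

open scoped InnerProductSpace ComplexConjugate

theorem multiplicativelyIndependent_const {q : ℕ+} (hq : q ≠ 1) :
    MultiplicativelyIndependent fun _ : Fin 1 => q := by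
  intro α h
  have hq2 : (1 : ℚ) < (q : ℕ) := by
    have := q.pos
    have : (q : ℕ) ≠ 1 := fun h => hq (PNat.coe_eq_one_iff.1 h)
    exact_mod_cast (by omega : 1 < (q : ℕ))
  rw [Fin.prod_univ_one, zpow_eq_one_iff_right₀ (by linarith) hq2.ne'] at h
  funext k
  rw [Subsingleton.elim k 0, h, Pi.zero_apply]

end DirichletHardy

namespace DirichletHardy

open scoped InnerProductSpace ComplexConjugate

/-- The functional `e` substitutes `z` for `Q⁻ˢ`, hence `c_j z^{k_j}` for `c_j q_j⁻ˢ`. When `q_j`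
shares no power with `Q` it kills all `q_j ^ m` with `m ≥ 1`; this is the case `k_j = 0`, in which
`positivePower` is `0`. -/
theorem inner_powerKernel_sum {ι : Type*} [Fintype ι] {a c x : ι → ℂ} {q : ι → ℕ+}
    (hq : ∀ j, q j ≠ 1) (hr : ∀ j, ‖c j‖ = (a j).re - 1 / 2) (ha : ∀ j, 1 / 2 < (a j).re)
    {φ : ι → HalfPlane (1 / 2) → HalfPlane (1 / 2)}
    (hφ : ∀ j s, (φ j s : ℂ) = a j + c j * ((q j : ℕ) : ℂ) ^ (-(s : ℂ)))
    {T : DirichletHardy →L[ℂ] DirichletHardy}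
    (hT : ∀ f, toFunction (T f) = (∑ j, x j • compositionOperator (φ j)) f)
    {Q : ℕ+} {k : ι → ℕ}
    (hk : ∀ j, (1 ≤ k j ∧ q j = Q ^ k j) ∨ (k j = 0 ∧ ∀ l m : ℕ, 1 ≤ l → q j ^ l ≠ Q ^ m))
    {z : ℂ} (hz : ‖z‖ < 1) {e : DirichletHardy}
    (he1 : ∀ m : ℕ, ⟪e, lp.single 2 (Q ^ m) (1 : ℂ)⟫_ℂ = z ^ m)
    (he2 : ∀ n : ℕ+, (∀ m : ℕ, n ≠ Q ^ m) → ⟪e, lp.single 2 n (1 : ℂ)⟫_ℂ = 0)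
    (u : ℂ) (hu : 1 / 2 < u.re) :
    ⟪e, T (kernel u hu)⟫_ℂ = ∑ j, x j * riemannZeta (u + (a j + positivePower (c j) (k j) z)) := by
  have hop := fun j => exists_operator_of_sum_norm_le (ha j)
    (multiplicativelyIndependent_const (hq j)) (fun _ => hq j) (c := fun _ => c j)
    (by simpa using (hr j).le) (φ := φ j) (fun s => by simpa using hφ j s)
  choose S hS1 hS2 using hop
  have hTS : ∀ f, T f = ∑ j, x j • S j f := fun f => by
    refine toFunction_injective ?_
    rw [hT, map_sum]
    simp only [map_smul, hS1, LinearMap.sum_apply, LinearMap.smul_apply]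
  rw [hTS, inner_sum]
  refine Finset.sum_congr rfl fun j _ => ?_
  rw [inner_smul_right]
  congr 1
  have hw : ‖positivePower (c j) (k j) z‖ < (a j).re - 1 / 2 := by
    refine (norm_positivePower_le _ _ hz.le).trans_lt ?_
    rw [hr]
    exact mul_lt_of_lt_one_right (by linarith [ha j]) hz
  have hs : 1 / 2 < (a j + positivePower (c j) (k j) z).re := by
    have := (abs_le.1 (Complex.abs_re_le_norm (positivePower (c j) (k j) z))).1
    rw [Complex.add_re]
    linarith
  rw [inner_operator_eq (ha j) (hS2 j) hw ?_ (kernel u hu) ⟨_, hs⟩ rfl, toFunction_kernel]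
  intro m
  rcases hk j with ⟨h1, h2⟩ | ⟨h1, h2⟩
  · rw [h2, ← pow_mul, he1, positivePower, if_neg (by omega), mul_pow, ← pow_mul]
  · rw [positivePower, if_pos h1]
    rcases Nat.eq_zero_or_pos m with rfl | hm
    · rw [pow_zero, pow_zero, pow_zero, one_mul, ← pow_zero Q, he1, pow_zero]
    · rw [he2 _ fun l => h2 m l hm, mul_zero, zero_pow hm.ne']

open Classical in
-- The sum is the limit of `⟪θ e_z, T (θ K_u)⟫` as `θ → 0⁺`, with `K_u` the reproducing kernel. Both
-- squared norms `‖e_z‖²` and `‖K_u‖²` grow like `θ⁻²`, so the normalised vectors are bounded, and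
-- compactness of `T` makes the limit `0`.
theorem sum_boundary_limit_eq_zero {ι : Type*} [Fintype ι] {a c x : ι → ℂ} {q : ι → ℕ+}
    (hq : ∀ j, q j ≠ 1) (hr : ∀ j, ‖c j‖ = (a j).re - 1 / 2) (ha : ∀ j, 1 / 2 < (a j).re)
    {φ : ι → HalfPlane (1 / 2) → HalfPlane (1 / 2)}
    (hφ : ∀ j s, (φ j s : ℂ) = a j + c j * ((q j : ℕ) : ℂ) ^ (-(s : ℂ)))
    {T : DirichletHardy →L[ℂ] DirichletHardy}
    (hT : ∀ f, toFunction (T f) = (∑ j, x j • compositionOperator (φ j)) f)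
    (hTc : IsCompactOperator T) {Q : ℕ+} (hQ : Q ≠ 1) {k : ι → ℕ}
    (hk : ∀ j, (1 ≤ k j ∧ q j = Q ^ k j) ∨ (k j = 0 ∧ ∀ l m : ℕ, 1 ≤ l → q j ^ l ≠ Q ^ m))
    {z₀ : ℂ} (hz₀ : ‖z₀‖ = 1) (τ x₀ : ℝ) {y : ℝ} (hy : 0 < y) :
    ∑ j, x j * (if a j - 1 / 2 - Complex.I * τ + positivePower (c j) (k j) z₀ = 0 ∧
        ((a j).re - 1 / 2) * k j = x₀ then
      ((y + ((a j).re - 1 / 2) * (k j + k j ^ 2 / 2) : ℝ) : ℂ)⁻¹ else 0) = 0 := by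
  set u : ℝ → ℂ := fun θ => 1 / 2 - Complex.I * τ + Complex.I * x₀ * θ + y * θ ^ 2 with hu
  set z : ℝ → ℂ := fun θ => z₀ * Complex.exp (Complex.I * θ - θ ^ 2) with hz
  have hure : ∀ θ, (u θ).re = 1 / 2 + y * θ ^ 2 := fun θ => by
    simp [hu, ← Complex.ofReal_pow, mul_assoc]
  have hu' : ∀ θ, 0 < θ → 1 / 2 < (u θ).re := fun θ hθ => by
    rw [hure]
    have : 0 < y * θ ^ 2 := by positivity
    linarith
  have hzn : ∀ θ, ‖z θ‖ = Real.exp (-θ ^ 2) := fun θ => by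
    rw [hz, norm_mul, hz₀, one_mul, norm_exp_I_mul_sub_sq]
  have hid : Tendsto (fun θ : ℝ => (θ : ℂ)) (nhdsWithin 0 (Set.Ioi 0)) (nhds 0) := by
    have h := Complex.continuous_ofReal.tendsto 0
    rw [Complex.ofReal_zero] at h
    exact h.mono_left nhdsWithin_le_nhds
  set F : ℝ → ℂ := fun θ => ∑ j, x j *
    ((θ : ℂ) ^ 2 * riemannZeta (u θ + (a j + positivePower (c j) (k j) (z θ)))) with hF
  have hlim1 := tendsto_finsetSum Finset.univ fun j _ =>
    (tendsto_sq_mul_riemannZeta_parabola (k := k j) hz₀ (hr j) (ha j) (τ := τ) (x₀ := x₀) hy).const_mul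
      (x j)
  refine tendsto_nhds_unique (f := F) hlim1 ?_
  let g : ℝ → DirichletHardy := fun θ =>
    if h : 1 / 2 < (u θ).re then (θ : ℂ) • kernel (u θ) h else 0
  have hg : ∀ θ, ∀ h : 0 < θ, g θ = (θ : ℂ) • kernel (u θ) (hu' θ h) := fun θ h => dif_pos (hu' θ h)
  have hgsq : ∀ θ, 0 < θ →
      ((‖g θ‖ ^ 2 : ℝ) : ℂ) = (θ : ℂ) ^ 2 * riemannZeta (1 + 2 * y * (θ : ℂ) ^ 2) := fun θ hθ => by
    rw [hg θ hθ, norm_smul, mul_pow, Complex.ofReal_mul, norm_sq_kernel, hure, Complex.norm_real,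
      Real.norm_eq_abs, sq_abs]
    push_cast
    ring_nf
  have hglim : Tendsto (fun θ => ((‖g θ‖ ^ 2 : ℝ) : ℂ)) (nhdsWithin 0 (Set.Ioi 0))
      (nhds ((2 * y : ℂ)⁻¹)) := by
    have hyc : (y : ℂ) ≠ 0 := by exact_mod_cast hy.ne'
    have hne : ∀ᶠ θ : ℝ in nhdsWithin (0 : ℝ) (Set.Ioi 0), 2 * y * (θ : ℂ) ^ 2 ≠ 0 := by
      filter_upwards [self_mem_nhdsWithin] with θ hθ
      have h1 : (θ : ℂ) ≠ 0 := by exact_mod_cast (ne_of_gt hθ : θ ≠ 0)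
      exact mul_ne_zero (mul_ne_zero two_ne_zero hyc) (pow_ne_zero 2 h1)
    refine (tendsto_mul_riemannZeta_of_zero (ε := fun θ : ℝ => (θ : ℂ) ^ 2)
      (E := fun θ : ℝ => 2 * y * (θ : ℂ) ^ 2) ?_ hne ?_).congr' ?_
    · simpa using (hid.pow 2).const_mul (2 * y : ℂ)
    · refine tendsto_const_nhds.congr' ?_
      filter_upwards [hne] with θ hθ
      have : (θ : ℂ) ^ 2 ≠ 0 := right_ne_zero_of_mul hθ
      rw [mul_comm (2 * (y : ℂ)), div_mul_eq_div_div, div_self this, one_div]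
    · filter_upwards [self_mem_nhdsWithin] with θ hθ
      rw [hgsq θ hθ]
  have hgbound : ∀ᶠ θ in nhdsWithin (0 : ℝ) (Set.Ioi 0), ‖g θ‖ ≤ √(‖(2 * y : ℂ)⁻¹‖ + 1) := by
    have := hglim.norm.eventually (ge_mem_nhds (lt_add_one _))
    filter_upwards [this] with θ hθ
    rw [Complex.norm_real, Real.norm_of_nonneg (sq_nonneg _)] at hθ
    exact Real.le_sqrt_of_sq_le hθ
  have hTg : Tendsto (fun θ => T (g θ)) (nhdsWithin 0 (Set.Ioi 0)) (nhds 0) := by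
    -- At a fixed `s` the zeta arguments `u + φ_j(s)` stay away from the pole because `Re φ_j(s) >
    -- 1/2`, so the factor `θ` sends the values to `0`.
    refine tendsto_zero_of_isCompactOperator hTc hgbound fun s => ?_
    have h : Tendsto (fun θ : ℝ => ∑ j, x j * ((θ : ℂ) * riemannZeta (1 + (u θ + φ j s - 1))))
        (nhdsWithin 0 (Set.Ioi 0)) (nhds (∑ j, x j * 0)) := by
      refine tendsto_finsetSum _ fun j _ => Tendsto.const_mul _ ?_
      have huc : Tendsto (fun θ => u θ + φ j s - 1) (nhdsWithin 0 (Set.Ioi 0))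
          (nhds (u 0 + φ j s - 1)) := by
        have : Continuous fun θ => u θ + φ j s - 1 := by fun_prop
        exact (this.tendsto 0).mono_left nhdsWithin_le_nhds
      refine tendsto_mul_riemannZeta_of_ne hid huc fun h => ?_
      have h1 := congrArg Complex.re h
      have h2 := (φ j s).2
      simp only [Complex.sub_re, Complex.add_re, hure, Complex.one_re, Complex.zero_re] at h1
      norm_num at h1
      linarith
    simp only [mul_zero, Finset.sum_const_zero] at h
    refine h.congr' ?_
    filter_upwards [self_mem_nhdsWithin] with θ hθ
    rw [hT, hg θ hθ, LinearMap.sum_apply, Finset.sum_apply]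
    refine Finset.sum_congr rfl fun j _ => ?_
    rw [LinearMap.smul_apply, map_smul, Pi.smul_apply, Pi.smul_apply, smul_eq_mul, smul_eq_mul,
      add_sub_cancel]
    congr 2
    exact (toFunction_kernel _ _ _).symm
  refine squeeze_zero_norm' (a := fun θ => √(3 / 2) * ‖T (g θ)‖) ?_ (by
    simpa using hTg.norm.const_mul √(3 / 2))
  filter_upwards [self_mem_nhdsWithin, mem_nhdsWithin_of_mem_nhds (Iic_mem_nhds one_pos)]
    with θ hθ hθ1
  have hθ : 0 < θ := hθ
  have hzlt : ‖z θ‖ < 1 := by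
    rw [hzn, Real.exp_lt_one_iff]
    have : 0 < θ ^ 2 := by positivity
    linarith
  obtain ⟨e, hen, he1, he2⟩ := exists_powerKernel hQ hzlt
  have hFe : F θ = ⟪((θ : ℂ) • e : DirichletHardy), T (g θ)⟫_ℂ := by
    rw [hg θ hθ, map_smul, inner_smul_left, inner_smul_right,
      inner_powerKernel_sum hq hr ha hφ hT hk hzlt he1 he2, Complex.conj_ofReal, ← mul_assoc,
      Finset.mul_sum]
    refine Finset.sum_congr rfl fun j _ => ?_
    ring
  rw [hFe]
  refine (norm_inner_le_norm _ _).trans (mul_le_mul_of_nonneg_right ?_ (norm_nonneg _))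
  refine Real.le_sqrt_of_sq_le ?_
  rw [norm_smul, mul_pow, Complex.norm_real, Real.norm_of_nonneg hθ.le]
  refine (mul_le_mul_of_nonneg_left hen (sq_nonneg θ)).trans ?_
  rw [hzn]
  exact sq_mul_inv_one_sub_exp_le hθ hθ1

/-- A combination of composition operators whose symbols map the boundary onto circles touching the
critical line is not compact. -/
theorem not_isCompactOnHardy_sum {ι : Type*} [Fintype ι] [Nonempty ι] {a c x : ι → ℂ} {q : ι → ℕ+}
    (hq : ∀ j, q j ≠ 1) (hr : ∀ j, ‖c j‖ = (a j).re - 1 / 2) (ha : ∀ j, 1 / 2 < (a j).re)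
    {φ : ι → HalfPlane (1 / 2) → HalfPlane (1 / 2)}
    (hφ : ∀ j s, (φ j s : ℂ) = a j + c j * ((q j : ℕ) : ℂ) ^ (-(s : ℂ)))
    (hinj : Function.Injective φ) (hx : ∀ j, x j ≠ 0) :
    ¬ IsCompactOnHardy (∑ j, x j • compositionOperator (φ j)) := by
  classical
  rintro ⟨T, hT, hTc⟩
  obtain ⟨j₀⟩ := (inferInstance : Nonempty ι)
  obtain ⟨Q, m₀, hQ, hm₀, hqm, hroot⟩ := exists_pow_root (q j₀) (hq j₀)
  have hkex : ∀ j, ∃ k : ℕ, (1 ≤ k ∧ q j = Q ^ k) ∨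
      (k = 0 ∧ ∀ l m : ℕ, 1 ≤ l → q j ^ l ≠ Q ^ m) := fun j => by
    rcases hroot (q j) (hq j) with ⟨k, h1, h2⟩ | h
    · exact ⟨k, Or.inl ⟨h1, h2⟩⟩
    · exact ⟨0, Or.inr ⟨rfl, h⟩⟩
  choose k hk using hkex
  have hk₀ : 1 ≤ k j₀ := by
    rcases hk j₀ with h | h
    · exact h.1
    · exact absurd ((pow_one _).trans hqm) (h.2 1 m₀ le_rfl)
  have hr0 : ∀ j, 0 < (a j).re - 1 / 2 := fun j => by linarith [ha j]
  have hc0 : ∀ j, c j ≠ 0 := fun j h => by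
    have h1 := hr j
    rw [h, norm_zero] at h1
    linarith [hr0 j]
  -- `z₀` is a boundary point at which `a + c z^k`, for the index `j₀`, touches the critical line.
  obtain ⟨z₀, hz₀⟩ := IsAlgClosed.exists_pow_nat_eq
    (-(((a j₀).re - 1 / 2 : ℝ) : ℂ) / c j₀) (by omega : 0 < k j₀)
  have hz₀n : ‖z₀‖ = 1 := by
    have h := congrArg norm hz₀
    rw [norm_pow, norm_div, norm_neg, Complex.norm_real, Real.norm_of_nonneg (hr0 j₀).le, hr j₀,
      div_self (hr0 j₀).ne'] at h
    exact (pow_eq_one_iff_of_nonneg (norm_nonneg _) (by omega)).1 h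
  set x₀ := ((a j₀).re - 1 / 2) * k j₀ with hx₀
  set A : Finset ι := Finset.univ.filter fun j =>
    a j - 1 / 2 - Complex.I * (a j₀).im + positivePower (c j) (k j) z₀ = 0 ∧
      ((a j).re - 1 / 2) * k j = x₀ with hA
  have hpos : ∀ j ∈ A, 1 ≤ k j := fun j hj => by
    have h := (Finset.mem_filter.1 hj).2.1
    by_contra h0
    rw [positivePower, if_pos (by omega)] at h
    have h1 := congrArg Complex.re h
    simp at h1
    linarith [hr0 j]
  have hj₀ : j₀ ∈ A := by
    refine Finset.mem_filter.2 ⟨Finset.mem_univ _, ?_, rfl⟩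
    rw [positivePower, if_neg (by omega), hz₀, mul_div_cancel₀ _ (hc0 j₀)]
    apply Complex.ext <;> simp
  -- Among surviving indices `k` determines the symbol: `r k = x₀` gives `r`, tangency at a common
  -- point gives `a`, the touching condition gives `c`, and `q = Q ^ k`.
  have hkinj : Set.InjOn k A := by
    intro i hi j hj hij
    have hi2 := (Finset.mem_filter.1 hi).2
    have hj2 := (Finset.mem_filter.1 hj).2
    have hki := hpos i hi
    have hkr : (0 : ℝ) < k i := by exact_mod_cast hki
    have hre : (a i).re - 1 / 2 = (a j).re - 1 / 2 := by
      have h := hi2.2.trans hj2.2.symm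
      rw [← hij] at h
      exact mul_right_cancel₀ hkr.ne' h
    have him : ∀ l ∈ A, (a l).im = (a j₀).im := fun l hl => by
      have h := (Finset.mem_filter.1 hl).2.1
      have hkl := hpos l hl
      rw [positivePower, if_neg (by omega)] at h
      have h1 : a l - 1 / 2 - Complex.I * (a j₀).im = -(c l * z₀ ^ k l) := by linear_combination h
      have h2 := congrArg (fun w => ‖w‖ ^ 2) h1
      simp only [norm_neg, norm_mul, norm_pow, hz₀n, one_pow, mul_one, hr l] at h2
      rw [Complex.sq_norm, Complex.normSq_apply] at h2
      simp at h2
      have h3 : ((a l).im - (a j₀).im) * ((a l).im - (a j₀).im) = 0 := by linarith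
      linarith [mul_self_eq_zero.1 h3]
    have hai : a i = a j := Complex.ext (by linarith) ((him i hi).trans (him j hj).symm)
    have hci : c i = c j := by
      have h1 := hi2.1
      have h2 := hj2.1
      rw [positivePower, if_neg (by omega)] at h1 h2
      rw [hai, hij] at h1
      have hz : z₀ ^ k j ≠ 0 := pow_ne_zero _ fun h => by rw [h, norm_zero] at hz₀n; norm_num at hz₀n
      exact mul_right_cancel₀ hz (by linear_combination h1 - h2)
    have hqi : q i = q j := by
      rcases hk i with h | h
      · rcases hk j with h' | h'
        · rw [h.2, h'.2, hij]
        · omega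
      · omega
    refine hinj (funext fun s => Subtype.ext ?_)
    rw [hφ, hφ, hai, hci, hqi]
  refine hx j₀ (eq_zero_of_sum_div_eq_zero (A := A)
    (p := fun j => ((a j).re - 1 / 2) * (k j + k j ^ 2 / 2)) ?_ (fun j _ => ?_) (fun y hy => ?_) j₀ hj₀)
  · intro i hi j hj hij
    have hi2 := (Finset.mem_filter.1 hi).2.2
    have hj2 := (Finset.mem_filter.1 hj).2.2
    have hx0 : x₀ ≠ 0 := by
      have : (0 : ℝ) < k j₀ := by exact_mod_cast hk₀
      exact (mul_pos (hr0 j₀) this).ne'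
    -- The second-order constant depends on `k` alone once `r k = x₀`, and injectively so; the poles
    -- are therefore distinct.
    have h1 : ∀ l, ((a l).re - 1 / 2) * k l = x₀ →
        ((a l).re - 1 / 2) * (k l + (k l : ℝ) ^ 2 / 2) = x₀ * (1 + k l / 2) := fun l hl => by
      rw [← hl]; ring
    simp only at hij
    rw [h1 i hi2, h1 j hj2] at hij
    have h2 := mul_left_cancel₀ hx0 hij
    refine hkinj hi hj ?_
    exact_mod_cast (by linarith : (k i : ℝ) = k j)
  · have := hr0 j
    positivity
  · have h := sum_boundary_limit_eq_zero hq hr ha hφ hT hTc hQ hk hz₀n (a j₀).im x₀ hy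
    rw [hA, Finset.sum_filter]
    simpa only [mul_ite, mul_zero] using h

end DirichletHardy

/-! ### Reduction of the theorem to touching symbols. -/

theorem IsCompactOnHardy.sum {ι : Type*} (s : Finset ι) (x : ι → ℂ)
    {L : ι → DirichletHardy →ₗ[ℂ] (HalfPlane (1 / 2) → ℂ)} (h : ∀ j ∈ s, IsCompactOnHardy (L j)) :
    IsCompactOnHardy (∑ j ∈ s, x j • L j) := by
  choose! T hT hTc using h
  refine ⟨∑ j ∈ s, x j • T j, fun f => ?_,
    (compactOperator (RingHom.id ℂ) DirichletHardy DirichletHardy).sum_mem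
      fun j hj => (hTc j hj).smul (x j)⟩
  rw [_root_.sum_apply, map_sum, LinearMap.sum_apply]
  refine Finset.sum_congr rfl fun j hj => ?_
  rw [_root_.smul_apply, map_smul, hT j hj, LinearMap.smul_apply]

theorem IsCompactOnHardy.sub {L M : DirichletHardy →ₗ[ℂ] (HalfPlane (1 / 2) → ℂ)}
    (hL : IsCompactOnHardy L) (hM : IsCompactOnHardy M) : IsCompactOnHardy (L - M) := by
  obtain ⟨S, hS, hSc⟩ := hL
  obtain ⟨T, hT, hTc⟩ := hM
  refine ⟨S - T, fun f => ?_, hSc.sub hTc⟩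
  rw [_root_.sub_apply, map_sub, hS, hT, LinearMap.sub_apply]

/-- A linear symbol of characteristic zero either induces a compact operator, or is of the form
`a + c q⁻ˢ` with `‖c‖ = Re a - 1 / 2`. -/
theorem isCompactOnHardy_or_touching {φ : HalfPlane (1 / 2) → HalfPlane (1 / 2)}
    (hG : IsGordonHedenmalm 0 φ) (hlin : IsLinearSymbol 0 φ) :
    IsCompactOnHardy (compositionOperator φ) ∨
      ∃ (a c : ℂ) (q : ℕ+), q ≠ 1 ∧ ‖c‖ = a.re - 1 / 2 ∧ 1 / 2 < a.re ∧
        ∀ s, (φ s : ℂ) = a + c * ((q : ℕ) : ℂ) ^ (-(s : ℂ)) := by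
  obtain ⟨a, d, q, c, hq, hq1, hc, hφ⟩ := hlin
  simp only [Nat.cast_zero, zero_mul, zero_add] at hφ
  have hle := sum_norm_le_of_isGordonHedenmalm hG hq hφ
  have ha : 1 / 2 < a.re := by
    rcases Nat.eq_zero_or_pos d with rfl | hd
    · have h := hφ ⟨1, by norm_num⟩
      simp only [Finset.univ_eq_empty, Finset.sum_empty, add_zero] at h
      rw [← h]
      exact (φ _).2
    · have : 0 < ∑ k, ‖c k‖ :=
        Finset.sum_pos (fun k _ => norm_pos_iff.2 (hc k)) ⟨⟨0, hd⟩, Finset.mem_univ _⟩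
      linarith
  by_cases h : d = 1 → ∑ k, ‖c k‖ < a.re - 1 / 2
  · exact Or.inl (DirichletHardy.isCompactOnHardy_linearSymbol ha hq hq1 hc hle h hφ)
  · push Not at h
    obtain ⟨rfl, h⟩ := h
    refine Or.inr ⟨a, c 0, q 0, hq1 0, ?_, ha, fun s => by simpa using hφ s⟩
    exact le_antisymm (by simpa using hle) (by simpa using h)

theorem mainTheorem3 (N : ℕ) (φ : Fin N → HalfPlane (1 / 2) → HalfPlane (1 / 2))
    (hdistinct : Function.Injective φ)
    (hG : ∀ j, IsGordonHedenmalm 0 (φ j))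
    (hlin : ∀ j, IsLinearSymbol 0 (φ j))
    (c : Fin N → ℂ) (hc : ∀ j, c j ≠ 0) :
    IsCompactOnHardy (∑ j, c j • compositionOperator (φ j)) ↔
      ∀ j, IsCompactOnHardy (compositionOperator (φ j)) := by
  classical
  refine ⟨fun h => ?_, fun h => IsCompactOnHardy.sum _ c fun j _ => h j⟩
  by_contra hne
  push Not at hne
  obtain ⟨j₀, hj₀⟩ := hne
  let p : Fin N → Prop := fun j => ¬ IsCompactOnHardy (compositionOperator (φ j))
  have htouch : ∀ j : {j // p j}, ∃ (a b : ℂ) (q : ℕ+), q ≠ 1 ∧ ‖b‖ = a.re - 1 / 2 ∧ 1 / 2 < a.re ∧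
      ∀ s, (φ j s : ℂ) = a + b * ((q : ℕ) : ℂ) ^ (-(s : ℂ)) := fun j =>
    (isCompactOnHardy_or_touching (hG j) (hlin j)).resolve_left j.2
  choose a b q hq hb ha hφ using htouch
  have : Nonempty {j // p j} := ⟨⟨j₀, hj₀⟩⟩
  refine DirichletHardy.not_isCompactOnHardy_sum hq hb ha hφ
    (hdistinct.comp Subtype.val_injective) (x := fun j : {j // p j} => c j) (fun j => hc j) ?_
  -- Removing the individually compact terms leaves a compact combination over the nonempty set of
  -- noncompact ones, all of which are touching.
  have h1 := h.sub (IsCompactOnHardy.sum (Finset.univ.filter fun j => ¬ p j) c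
    (L := fun j => compositionOperator (φ j)) fun j hj => not_not.1 (Finset.mem_filter.1 hj).2)
  rw [← Finset.sum_filter_add_sum_filter_not Finset.univ p, add_sub_cancel_right,
    ← Finset.sum_subtype_eq_sum_filter, Finset.subtype_univ] at h1
  exact h1
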